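/- A \emph{weakly increasing binary tree} is a non-empty rooted binary plane tree (every node has no child, only a left child, only a right child, or both a left and a right child) whose nodes are labeled by positive integers such that the labels are strictly increasing along each branch starting from the root and the set of labels occurring in the tree is $\{1,2,\dots,m\}$, where $m$ is the maximal label; the same label may occur several times in distinct branches. The tree is completed by attaching unlabeled leaves to its labeled nodes so that every labeled node has exactly two children, and the \emph{size} of the tree is the number of leaves of the completed tree. Let $B_n$ be the number of weakly increasing binary trees of size $n$; it is finite for every $n$. Then there is a constant $\eta$ such that \[ B_n \sim \eta\; n^{-\ln 2}\left(\frac{1}{\ln 2}\right)^{n}(n-1)! \qquad (n\to\infty), \] where $\eta = 0.647807\dots$, that is, $0.647807 < \eta < 0.647808$. -/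

import Mathlib

namespace WeaklyIncreasing

/-- The set of labels occurring in a binary plane tree whose (internal) nodes carry
natural-number labels. The constructor `nil` is an absent child, that is, one of the
unlabeled leaves that are added when the tree is completed. -/
def labels : BinaryTree ℕ → Finset ℕ
  | .nil => ∅
  | .node k l r => insert k (labels l ∪ labels r)

/-- Along each branch, starting from the root, the labels are strictly increasing:
every label is smaller than all labels of proper descendants. -/
def Increasing : BinaryTree ℕ → Prop
  | .nil => True
  | .node k l r =>
      (∀ j ∈ labels l, k < j) ∧ (∀ j ∈ labels r, k < j) ∧ Increasing l ∧ Increasing r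

/-- A weakly increasing binary tree: the labels strictly increase along each branch, and the
set of labels is exactly `{1, …, m}`, where `m ≥ 1` is the maximal label (so the tree has at
least one node). The same label may occur in distinct branches. -/
def IsWeaklyIncreasing (t : BinaryTree ℕ) : Prop :=
  Increasing t ∧ ∃ m : ℕ, 1 ≤ m ∧ labels t = Finset.Icc 1 m

/-- The weakly increasing binary trees of size `n`. The size is the number of leaves of the
completed tree, i.e. the number of occurrences of `nil`. -/
def treesOfSize (n : ℕ) : Set (BinaryTree ℕ) :=
  {t | IsWeaklyIncreasing t ∧ t.numLeaves = n}

/-- `B n` is the number of weakly increasing binary trees of size `n`. -/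
noncomputable def B (n : ℕ) : ℕ :=
  (treesOfSize n).ncard

end WeaklyIncreasing

namespace WeaklyIncreasing

/-! Removing all nodes that carry the largest label inverts the following step: keep each leaf or
replace it by a node with two leaves, replacing at least one. A tree with k leaves therefore has
C(k, n - k) successors with n leaves. If `b n` counts the trees with n leaves, the single leaf
included, then b n = ∑_{k<n} C(k, n - k) b k for n ≥ 2 (`b_rec`).

Adding the term k = n turns this into 2 b n = ∑_k C(k, n - k) b k, whose adjoint equation is ∑_j
C(k, j) h (k + j) = 2 h k. Write ℓ = ln 2. Since C(k, j) is about k^j / j! and e^ℓ = 2, the function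
ℓ^k / Γ(k) solves the adjoint equation to leading order. Replacing Γ(k) by Γ(k - ℓ) removes the next
order, and the coefficients `d₁` and `d₂` remove two more, so `harm` has relative defect O(k⁻⁴)
(`abs_residual_le`). The truncation errors are controlled term by term: the ratios involved are
terminating ₂F₁ series at 1, and their partial sums are off by at most the first omitted term
(`abs_choose_div_sub_le`).

The flux `invar n` = ∑_{k ≤ n < i} b k C(k, i - k) h i would be constant for an exact solution h.
Here it changes by the defect only (`invar_succ`), so it converges, with an explicit O(n⁻³) relative
error (`exists_tendsto_invar`). In terms of `nb n` = b n · h n, the flux is asymptotically a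
convolution of `nb` with weights of total mass 2ℓ. The current term has mass e^ℓ - 1 = 1 and the
earlier ones 2ℓ - 1 < 1, so a contraction argument shows that `nb` converges to lim `invar` / (2ℓ)
(`tendsto_nb`). This limit is η, and Γ(n - ℓ) ~ n^(-ℓ) (n - 1)! gives the stated form
(`isEquivalent_B`).

For the digits of η, `invar 256` is enclosed by exact integer arithmetic, and Γ(256 - ℓ) by an
expansion of log Γ with explicit error (`invar_256_bounds`). -/

open Finset

/-! ### Building trees one label at a time, and the recurrence for the counts. -/

/-- The trees obtained from a given tree by replacing some of its leaves by nodes labelled `m`. -/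
def grow (m : ℕ) : BinaryTree ℕ → Finset (BinaryTree ℕ)
  | .nil => {.nil, .node m .nil .nil}
  | .node k l r => (grow m l ×ˢ grow m r).image fun p => .node k p.1 p.2

/-- The tree obtained by cutting off all nodes labelled `m`. -/
def prune (m : ℕ) : BinaryTree ℕ → BinaryTree ℕ
  | .nil => .nil
  | .node k l r => if k = m then .nil else .node k (prune m l) (prune m r)

lemma labels_eq_empty {t : BinaryTree ℕ} (h : labels t = ∅) : t = .nil := by
  cases t with
  | nil => rfl
  | node k l r => simp [labels] at h

/-- A node carrying the upper bound `m` has no labelled descendants, so pruning it loses nothing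
that growing cannot restore. -/
lemma mem_grow_prune {m : ℕ} {t : BinaryTree ℕ} (ht : Increasing t)
    (hm : ∀ j ∈ labels t, j ≤ m) :
    t ∈ grow m (prune m t) ∧ labels (prune m t) = (labels t).erase m ∧
      Increasing (prune m t) := by
  induction t with
  | nil => simp [grow, prune, labels, Increasing]
  | node k l r ihl ihr =>
    obtain ⟨hl, hr, il, ir⟩ := ht
    simp only [labels, mem_insert, mem_union, forall_eq_or_imp] at hm
    obtain ⟨hkm, hm⟩ := hm
    obtain ⟨a1, a2, a3⟩ := ihl il fun j hj => hm j (Or.inl hj)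
    obtain ⟨b1, b2, b3⟩ := ihr ir fun j hj => hm j (Or.inr hj)
    by_cases hk : k = m
    · subst hk
      have el : labels l = ∅ := eq_empty_of_forall_notMem fun j hj =>
        absurd (hm j (Or.inl hj)) (not_le.2 (hl j hj))
      have er : labels r = ∅ := eq_empty_of_forall_notMem fun j hj =>
        absurd (hm j (Or.inr hj)) (not_le.2 (hr j hj))
      rw [labels_eq_empty el, labels_eq_empty er]
      simp [grow, prune, labels, Increasing]
    · refine ⟨?_, ?_, ?_⟩
      · simp only [prune, hk, if_false, grow, mem_image, mem_product, Prod.exists]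
        exact ⟨l, r, ⟨a1, b1⟩, rfl⟩
      · simp only [prune, hk, if_false, labels, a2, b2]
        ext x
        simp only [mem_insert, mem_union, mem_erase]
        grind
      · simp only [prune, hk, if_false, Increasing, a2, b2]
        exact ⟨fun j hj => hl j (mem_of_mem_erase hj), fun j hj => hr j (mem_of_mem_erase hj),
          a3, b3⟩

lemma of_mem_grow {m : ℕ} {s t : BinaryTree ℕ} (hs : Increasing s) (hm : ∀ j ∈ labels s, j < m)
    (ht : t ∈ grow m s) :
    Increasing t ∧ labels s ⊆ labels t ∧ labels t ⊆ insert m (labels s) ∧ prune m t = s := by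
  induction s generalizing t with
  | nil =>
    simp only [grow, mem_insert, mem_singleton] at ht
    rcases ht with rfl | rfl <;> simp [prune, labels, Increasing]
  | node k l r ihl ihr =>
    obtain ⟨hl, hr, il, ir⟩ := hs
    simp only [grow, mem_image, mem_product, Prod.exists] at ht
    obtain ⟨l', r', ⟨hl', hr'⟩, rfl⟩ := ht
    simp only [labels, mem_insert, mem_union, forall_eq_or_imp] at hm
    obtain ⟨hkm, hm⟩ := hm
    obtain ⟨a1, a2, a3, a4⟩ := ihl il (fun j hj => hm j (Or.inl hj)) hl'
    obtain ⟨b1, b2, b3, b4⟩ := ihr ir (fun j hj => hm j (Or.inr hj)) hr'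
    refine ⟨⟨?_, ?_, a1, b1⟩, ?_, ?_, ?_⟩
    · intro j hj
      rcases mem_insert.1 (a3 hj) with rfl | h
      · exact hkm
      · exact hl j h
    · intro j hj
      rcases mem_insert.1 (b3 hj) with rfl | h
      · exact hkm
      · exact hr j h
    · exact insert_subset_insert _ (union_subset_union a2 b2)
    · intro x hx
      simp only [labels, mem_insert, mem_union] at hx ⊢
      rcases hx with rfl | hx | hx
      · simp
      · have := a3 hx
        simp only [mem_insert] at this
        tauto
      · have := b3 hx
        simp only [mem_insert] at this
        tauto
    · simp [prune, hkm.ne, a4, b4]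

-- Leaves are treated independently: a kept leaf contributes X and a replaced one X².
open Polynomial in
lemma sum_grow_X_pow (m : ℕ) (s : BinaryTree ℕ) :
    ∑ t ∈ grow m s, (X : ℕ[X]) ^ t.numLeaves = (X + X ^ 2) ^ s.numLeaves := by
  induction s with
  | nil =>
    rw [grow, sum_insert (by simp), sum_singleton]
    simp [BinaryTree.numLeaves]
  | node k l r ihl ihr =>
    rw [grow, sum_image, sum_product]
    · simp only [BinaryTree.numLeaves, pow_add, ← ihl, ← ihr, sum_mul_sum]
    · rintro ⟨a, b⟩ _ ⟨c, d⟩ _ h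
      simpa using h

open Polynomial in
lemma card_grow (m : ℕ) (s : BinaryTree ℕ) {n : ℕ} (hn : s.numLeaves ≤ n) :
    #{t ∈ grow m s | t.numLeaves = n} = s.numLeaves.choose (n - s.numLeaves) := by
  have h := congrArg (fun p => coeff p n) (sum_grow_X_pow m s)
  have e : ((X : ℕ[X]) + X ^ 2) ^ s.numLeaves = X ^ s.numLeaves * (1 + X) ^ s.numLeaves := by
    rw [← mul_pow]; ring
  simp only [e, finsetSum_coeff, coeff_X_pow] at h
  rw [card_filter]
  simp only [eq_comm (b := n)]
  rw [h, coeff_X_pow_mul', if_pos hn, coeff_one_add_X_pow]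
  simp

lemma grow_numLeaves {m : ℕ} {s t : BinaryTree ℕ} (ht : t ∈ grow m s) (hs : m ∉ labels s) :
    s.numLeaves ≤ t.numLeaves ∧ (m ∈ labels t ↔ s.numLeaves < t.numLeaves) := by
  induction s generalizing t with
  | nil =>
    simp only [grow, mem_insert, mem_singleton] at ht
    rcases ht with rfl | rfl <;> simp [labels, BinaryTree.numLeaves]
  | node k l r ihl ihr =>
    simp only [grow, mem_image, mem_product, Prod.exists] at ht
    obtain ⟨l', r', ⟨hl', hr'⟩, rfl⟩ := ht
    simp only [labels, mem_insert, mem_union, not_or] at hs ⊢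
    obtain ⟨a1, a2⟩ := ihl hl' hs.2.1
    obtain ⟨b1, b2⟩ := ihr hr' hs.2.2
    simp only [BinaryTree.numLeaves, a2, b2, hs.1, false_or]
    omega

/-- The increasing trees whose set of labels is `{1, …, m}`. -/
def fullTrees : ℕ → Finset (BinaryTree ℕ)
  | 0 => {.nil}
  | m + 1 => ((fullTrees m).biUnion (grow (m + 1))).filter (m + 1 ∈ labels ·)

lemma mem_fullTrees {m : ℕ} {t : BinaryTree ℕ} :
    t ∈ fullTrees m ↔ Increasing t ∧ labels t = Icc 1 m := by
  induction m generalizing t with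
  | zero =>
    simp only [fullTrees, mem_singleton]
    constructor
    · rintro rfl
      simp [Increasing, labels]
    · rintro ⟨-, h⟩
      exact labels_eq_empty (by simpa using h)
  | succ m ih =>
    simp only [fullTrees, mem_filter, mem_biUnion, ih]
    constructor
    · rintro ⟨⟨s, ⟨hs, hl⟩, ht⟩, hm⟩
      have hlt : ∀ j ∈ labels s, j < m + 1 := by
        intro j hj
        rw [hl, mem_Icc] at hj
        omega
      obtain ⟨h1, h2, h3, -⟩ := of_mem_grow hs hlt ht
      refine ⟨h1, ?_⟩
      have : insert (m + 1) (Icc 1 m) = Icc 1 (m + 1) := by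
        ext x; simp only [mem_insert, mem_Icc]; omega
      rw [← this, ← hl]
      exact Subset.antisymm h3 (insert_subset hm h2)
    · rintro ⟨h1, h2⟩
      obtain ⟨a1, a2, a3⟩ := mem_grow_prune (m := m + 1) h1
        (fun j hj => by rw [h2, mem_Icc] at hj; exact hj.2)
      refine ⟨⟨_, ⟨a3, ?_⟩, a1⟩, by rw [h2]; simp⟩
      rw [a2, h2]
      ext x; simp only [mem_erase, mem_Icc]; omega

/-- The number of increasing trees with `n` leaves whose set of labels is `{1, …, m}`. -/
def fullCount (m n : ℕ) : ℕ := #{t ∈ fullTrees m | t.numLeaves = n}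

lemma fullCount_zero (n : ℕ) : fullCount 0 n = if n = 1 then 1 else 0 := by
  rw [fullCount, fullTrees, filter_singleton]
  simp only [BinaryTree.numLeaves, eq_comm (a := 1)]
  split_ifs <;> simp

lemma card_labels_lt (t : BinaryTree ℕ) : #(labels t) < t.numLeaves := by
  induction t with
  | nil => simp [labels, BinaryTree.numLeaves]
  | node k l r ihl ihr =>
    have h1 := card_insert_le k (labels l ∪ labels r)
    have h2 := card_union_le (labels l) (labels r)
    simp only [labels, BinaryTree.numLeaves]
    omega

lemma fullTrees_numLeaves {m : ℕ} {t : BinaryTree ℕ} (ht : t ∈ fullTrees m) :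
    m < t.numLeaves := by
  have := card_labels_lt t
  rwa [(mem_fullTrees.1 ht).2, Nat.card_Icc, Nat.add_sub_cancel] at this

lemma fullCount_eq_zero {m n : ℕ} (h : n ≤ m) : fullCount m n = 0 := by
  rw [fullCount, card_eq_zero, filter_eq_empty_iff]
  intro t ht
  have := fullTrees_numLeaves ht
  omega

/-- Label m + 1 occurs exactly when some leaf was replaced, that is, when the leaf number grew;
hence the strict range k < n. Different parents have disjoint offspring because `prune` recovers the
parent. -/
lemma fullCount_succ (m n : ℕ) :
    fullCount (m + 1) n = ∑ k ∈ range n, k.choose (n - k) * fullCount m k := by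
  have hlt {s : BinaryTree ℕ} (hs : s ∈ fullTrees m) : ∀ j ∈ labels s, j < m + 1 := by
    intro j hj
    rw [(mem_fullTrees.1 hs).2, mem_Icc] at hj
    omega
  have key : {t ∈ fullTrees (m + 1) | t.numLeaves = n} =
      {s ∈ fullTrees m | s.numLeaves < n}.biUnion
        fun s => {t ∈ grow (m + 1) s | t.numLeaves = n} := by
    ext t
    simp only [fullTrees, mem_filter, mem_biUnion]
    constructor
    · rintro ⟨⟨⟨s, hs, ht⟩, hm⟩, rfl⟩
      exact ⟨s, ⟨hs, (grow_numLeaves ht fun h => (hlt hs _ h).false).2.1 hm⟩, ht, rfl⟩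
    · rintro ⟨s, ⟨hs, hn⟩, ht, rfl⟩
      exact ⟨⟨⟨s, hs, ht⟩, (grow_numLeaves ht fun h => (hlt hs _ h).false).2.2 hn⟩, rfl⟩
  rw [fullCount, key, card_biUnion]
  · rw [sum_congr rfl fun s hs => card_grow (m + 1) s (mem_filter.1 hs).2.le]
    rw [← sum_fiberwise_of_maps_to (t := range n) (g := BinaryTree.numLeaves)
      (fun s hs => mem_range.2 (mem_filter.1 hs).2)]
    refine sum_congr rfl fun k hk => ?_
    rw [filter_filter, sum_congr rfl (g := fun _ => k.choose (n - k)), sum_const, smul_eq_mul,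
      mul_comm, fullCount]
    · congr 2
      ext s
      simp only [mem_filter]
      have := mem_range.1 hk
      constructor
      · rintro ⟨a, b, c⟩; exact ⟨a, c⟩
      · rintro ⟨a, c⟩; exact ⟨a, by omega, c⟩
    · intro s hs
      rw [(mem_filter.1 hs).2.2]
  · intro s hs s' hs' hne
    rw [Function.onFun, disjoint_left]
    intro t ht ht'
    rw [mem_coe, mem_filter] at hs hs'
    rw [mem_filter] at ht ht'
    apply hne
    rw [← (of_mem_grow (mem_fullTrees.1 hs.1).1 (hlt hs.1) ht.1).2.2.2,
      (of_mem_grow (mem_fullTrees.1 hs'.1).1 (hlt hs'.1) ht'.1).2.2.2]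

/-- The number of weakly increasing trees with `n` leaves, the single leaf included. -/
def b (n : ℕ) : ℕ := ∑ m ∈ range n, fullCount m n

lemma b_zero : b 0 = 0 := by simp [b]

lemma b_one : b 1 = 1 := by simp [b, fullCount_zero]

lemma sum_fullCount {k n : ℕ} (h : k ≤ n) : ∑ m ∈ range n, fullCount m k = b k := by
  rw [b, ← sum_subset (range_subset_range.2 h)]
  intro m _ hm
  exact fullCount_eq_zero (by simpa using hm)

lemma b_rec {n : ℕ} (hn : 2 ≤ n) : b n = ∑ k ∈ range n, k.choose (n - k) * b k := by
  obtain ⟨n, rfl⟩ := Nat.exists_eq_add_of_le' hn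
  rw [b, show n + 2 = (n + 1) + 1 from rfl, sum_range_succ', fullCount_zero]
  simp only [fullCount_succ]
  rw [sum_comm]
  simp only [← mul_sum]
  rw [if_neg (by omega), add_zero]
  refine sum_congr rfl fun k hk => ?_
  rw [sum_fullCount (by have := mem_range.1 hk; omega)]

lemma mem_treesOfSize {n : ℕ} {t : BinaryTree ℕ} :
    t ∈ treesOfSize n ↔ ∃ m ∈ Ico 1 n, t ∈ {t ∈ fullTrees m | t.numLeaves = n} := by
  simp only [treesOfSize, IsWeaklyIncreasing, Set.mem_ofPred_eq, mem_filter, mem_Ico]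
  constructor
  · rintro ⟨⟨h1, m, hm, h2⟩, rfl⟩
    have := mem_fullTrees.2 ⟨h1, h2⟩
    exact ⟨m, ⟨hm, fullTrees_numLeaves this⟩, this, rfl⟩
  · rintro ⟨m, hm, h, rfl⟩
    exact ⟨⟨(mem_fullTrees.1 h).1, m, hm.1, (mem_fullTrees.1 h).2⟩, rfl⟩

lemma treesOfSize_eq (n : ℕ) :
    treesOfSize n = ((Ico 1 n).biUnion fun m => {t ∈ fullTrees m | t.numLeaves = n} :
      Finset (BinaryTree ℕ)) := by
  ext t
  rw [mem_coe, mem_biUnion, mem_treesOfSize]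

lemma treesOfSize_finite (n : ℕ) : (treesOfSize n).Finite := by
  rw [treesOfSize_eq]
  exact finite_toSet _

/-- The two differ only at n = 1, where `b` counts the bare leaf (the term m = 0). -/
lemma B_eq_b {n : ℕ} (hn : 2 ≤ n) : B n = b n := by
  rw [B, treesOfSize_eq, Set.ncard_coe_finset, card_biUnion, b, range_eq_Ico,
    sum_eq_sum_Ico_succ_bot (by omega : 0 < n) fun m => fullCount m n, fullCount_zero, if_neg (by omega), zero_add]
  · rfl
  · intro m _ m' _ hne
    rw [Function.onFun, disjoint_left]
    intro t ht ht'
    rw [mem_filter, mem_fullTrees] at ht ht'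
    apply hne
    have := congrArg card (ht.1.2.symm.trans ht'.1.2)
    simpa using this

/-! ### Rising factorials and truncated Chu–Vandermonde sums. -/

/-- The rising factorial `a (a + 1) ⋯ (a + s - 1)`. -/
noncomputable def rf (a : ℝ) (s : ℕ) : ℝ := ∏ i ∈ range s, (a + i)

@[simp] lemma rf_zero (a : ℝ) : rf a 0 = 1 := by simp [rf]

lemma rf_succ (a : ℝ) (s : ℕ) : rf a (s + 1) = rf a s * (a + s) := prod_range_succ _ _

lemma rf_succ' (a : ℝ) (s : ℕ) : rf a (s + 1) = a * rf (a + 1) s := by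
  rw [rf, prod_range_succ', mul_comm, rf]
  simp only [Nat.cast_zero, add_zero, Nat.cast_add, Nat.cast_one]
  congr 1
  exact prod_congr rfl fun i _ => by ring

lemma rf_nonneg {a : ℝ} (ha : 0 ≤ a) (s : ℕ) : 0 ≤ rf a s :=
  prod_nonneg fun i _ => by positivity

lemma rf_pos {a : ℝ} (ha : 0 < a) (s : ℕ) : 0 < rf a s :=
  prod_pos fun i _ => by positivity

lemma Gamma_add_nat {a : ℝ} (ha : 0 < a) (s : ℕ) :
    Real.Gamma (a + s) = Real.Gamma a * rf a s := by
  induction s with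
  | zero => simp
  | succ s ih =>
    rw [rf_succ, ← mul_assoc, ← ih, Nat.cast_succ, ← add_assoc, Real.Gamma_add_one (by positivity),
      mul_comm]

/-- The terms, up to sign, of the terminating hypergeometric series `₂F₁(-j, b; d; 1)`. -/
noncomputable def vterm (b d : ℝ) (j s : ℕ) : ℝ := j.choose s * rf b s / rf d s

/-- The sum of the first `S` terms of `₂F₁(-j, b; d; 1)`. -/
noncomputable def vsum (b d : ℝ) (j S : ℕ) : ℝ := ∑ s ∈ range S, (-1) ^ s * vterm b d j s

/-- The closed form of `₂F₁(-j, b; d; 1)`. -/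
noncomputable def vfull (b d : ℝ) (j : ℕ) : ℝ := rf (d - b) j / rf d j

lemma vterm_nonneg {b d : ℝ} (hb : 0 ≤ b) (hd : 0 < d) (j s : ℕ) : 0 ≤ vterm b d j s :=
  div_nonneg (mul_nonneg (Nat.cast_nonneg _) (rf_nonneg hb s)) (rf_pos hd s).le

lemma vsum_succ (b d : ℝ) (j S : ℕ) :
    vsum b d j (S + 1) = vsum b d j S + (-1) ^ S * vterm b d j S := sum_range_succ _ _

lemma vterm_zero (b d : ℝ) (j : ℕ) : vterm b d j 0 = 1 := by simp [vterm]

lemma vterm_succ_succ {b d : ℝ} (hd : 0 < d) (j s : ℕ) :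
    vterm b d (j + 1) (s + 1) = vterm b d j (s + 1) + b / d * vterm (b + 1) (d + 1) j s := by
  have h := (rf_pos (by linarith : 0 < d + 1) s).ne'
  simp only [vterm, Nat.choose_succ_succ, Nat.cast_add, rf_succ' b, rf_succ' d]
  field_simp
  ring

lemma vsum_succ_succ {b d : ℝ} (hd : 0 < d) (j S : ℕ) :
    vsum b d (j + 1) (S + 1) = vsum b d j (S + 1) - b / d * vsum (b + 1) (d + 1) j S := by
  simp only [vsum, sum_range_succ' _ S, vterm_zero, vterm_succ_succ hd, mul_sum, mul_add,
    sum_add_distrib, pow_succ]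
  have : ∀ s, (-1 : ℝ) ^ s * -1 * (b / d * vterm (b + 1) (d + 1) j s) =
      -(b / d * ((-1) ^ s * vterm (b + 1) (d + 1) j s)) := fun s => by ring
  simp only [this, sum_neg_distrib]
  ring

lemma vfull_succ {b d : ℝ} (hd : 0 < d) (j : ℕ) :
    vfull b d (j + 1) = vfull b d j - b / d * vfull (b + 1) (d + 1) j := by
  have h1 := (rf_pos hd j).ne'
  have h2 : d + j ≠ 0 := by positivity
  have h3 : rf (d + 1) j = rf d j * (d + j) / d := by
    rw [← rf_succ, rf_succ']; field_simp
  rw [vfull, vfull, vfull, h3, rf_succ, rf_succ, show d + 1 - (b + 1) = d - b by ring]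
  field_simp
  ring

/-- The Chu–Vandermonde identity. -/
lemma vsum_eq_vfull {b d : ℝ} (hd : 0 < d) {j S : ℕ} (h : j < S) :
    vsum b d j S = vfull b d j := by
  induction j generalizing b d S with
  | zero =>
    obtain ⟨S, rfl⟩ := Nat.exists_eq_add_of_lt h
    simp [vsum, sum_range_succ', vterm, vfull]
  | succ j ih =>
    obtain ⟨S, rfl⟩ := Nat.exists_eq_add_of_le' (Nat.one_le_of_lt h)
    rw [vsum_succ_succ hd, vfull_succ hd, ih hd (by omega), ih (by linarith) (by omega)]

/-- By Pascal's rule, the remainder at (j + 1, S + 1) is the remainder at (j, S + 1) minus b/d times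
the one at (j, S) with both parameters raised by 1. The two remainders have opposite signs by
induction, so their contributions agree in sign. -/
lemma vsum_alternating {b d : ℝ} (hb : 0 ≤ b) (hd : 0 < d) (hbd : b ≤ d) (j S : ℕ) :
    0 ≤ (-1) ^ S * (vfull b d j - vsum b d j S) := by
  induction j generalizing b d S with
  | zero =>
    cases S with
    | zero => simp [vsum, vfull]
    | succ S => rw [vsum_eq_vfull hd (by omega)]; simp
  | succ j ih =>
    cases S with
    | zero =>
      have := div_nonneg (rf_nonneg (sub_nonneg.2 hbd) (j + 1)) (rf_pos hd (j + 1)).le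
      simpa [vsum, vfull] using this
    | succ S =>
      rw [vsum_succ_succ hd, vfull_succ hd]
      have h1 := ih hb hd hbd (S + 1)
      have h2 := mul_nonneg (div_nonneg hb hd.le)
        (ih (by linarith : 0 ≤ b + 1) (by linarith : 0 < d + 1) (by linarith) S)
      rw [pow_succ] at h1 ⊢
      linarith

lemma abs_vfull_sub_vsum_le {b d : ℝ} (hb : 0 ≤ b) (hd : 0 < d) (hbd : b ≤ d) (j S : ℕ) :
    |vfull b d j - vsum b d j S| ≤ vterm b d j S := by
  have h1 := vsum_alternating hb hd hbd j S
  have h2 := vsum_alternating hb hd hbd j (S + 1)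
  rw [vsum_succ, pow_succ] at h2
  rcases neg_one_pow_eq_or ℝ S with h | h <;> rw [h] at h1 h2 <;> rw [abs_le] <;>
    constructor <;> linarith [vterm_nonneg hb hd j S]

lemma vterm_le_succ {b d : ℝ} (hd : 0 < d) (hbd : d ≤ b) {j s : ℕ} (hs : s < j / 2) :
    vterm b d j s ≤ vterm b d j (s + 1) := by
  have hb : 0 < b := hd.trans_le hbd
  have h1 := rf_pos hd s
  have h2 := rf_pos hb s
  have h3 : (j.choose s : ℝ) ≤ j.choose (s + 1) := by
    exact_mod_cast Nat.choose_le_succ_of_lt_half_left hs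
  have h4 : 0 < d + s := by positivity
  rw [vterm, vterm, rf_succ, rf_succ, div_le_div_iff₀ h1 (by positivity)]
  have : (j.choose s : ℝ) * (d + s) ≤ j.choose (s + 1) * (b + s) := by
    gcongr
  calc _ = (j.choose s * (d + s)) * (rf b s * rf d s) := by ring
    _ ≤ (j.choose (s + 1) * (b + s)) * (rf b s * rf d s) := by gcongr
    _ = _ := by ring

/-- Up to the middle of the binomial row the terms increase, so the partial sums alternate in sign
and stay below the next term. -/
lemma abs_vsum_le {b d : ℝ} (hd : 0 < d) (hbd : d ≤ b) {j S : ℕ} (hS : S ≤ j / 2) :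
    |vsum b d j S| ≤ vterm b d j S := by
  have key : ∀ S ≤ j / 2, 0 ≤ -((-1) ^ S * vsum b d j S) ∧
      -((-1) ^ S * vsum b d j S) ≤ vterm b d j S := by
    intro S hS
    induction S with
    | zero => simp [vsum, vterm]
    | succ S ih =>
      obtain ⟨h1, h2⟩ := ih (by omega)
      have h3 := vterm_le_succ hd hbd (j := j) (s := S) (by omega)
      have h4 : ((-1 : ℝ) ^ S) * (-1) ^ S = 1 := by rw [← mul_pow]; simp
      have h5 : -((-1) ^ (S + 1) * vsum b d j (S + 1)) =
          (-1) ^ S * vsum b d j S + vterm b d j S := by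
        rw [vsum_succ, pow_succ]
        linear_combination vterm b d j S * h4
      rw [h5]
      constructor <;> linarith
  obtain ⟨h1, h2⟩ := key S hS
  rcases neg_one_pow_eq_or ℝ S with h | h <;> rw [h] at h1 h2 <;> rw [abs_le] <;>
    constructor <;> linarith

lemma rf_eq_zero {a : ℝ} {i s : ℕ} (h : a + i = 0) (hi : i < s) : rf a s = 0 :=
  prod_eq_zero (mem_range.2 hi) h

lemma choose_mul_factorial_eq_rf (k j : ℕ) :
    (k.choose j : ℝ) * j.factorial = rf (k - j + 1) j := by
  have h : ((k.choose j * j.factorial : ℕ) : ℝ) = (k.descFactorial j : ℕ) := by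
    rw [Nat.descFactorial_eq_factorial_mul_choose, mul_comm]
  rw [Nat.cast_mul] at h
  rw [h]
  clear h
  induction j with
  | zero => simp
  | succ j ih =>
    rw [Nat.descFactorial_succ, rf_succ', Nat.cast_mul, ih]
    rcases le_or_gt j k with hjk | hjk
    · rw [Nat.cast_sub hjk]
      push_cast
      ring_nf
    · rw [Nat.sub_eq_zero_of_le hjk.le]
      have : rf ((k : ℝ) - j + 1) j = 0 :=
        rf_eq_zero (i := j - 1 - k) (by
          rw [Nat.cast_sub (by omega), Nat.cast_sub (by omega)]; push_cast; ring) (by omega)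
      push_cast
      rw [show (k : ℝ) - (j + 1) + 1 + 1 = k - j + 1 by ring, this]
      simp

/-- The truncation error of the expansion of `C(k, j) j! Γ(k + c) / Γ(k + j + c)` is at most the
first omitted term. -/
lemma abs_choose_div_sub_le {c : ℝ} {k j S : ℕ} (hc : -1 ≤ c) (hk : 6 ≤ k) (hS : 2 ≤ S)
    (hS4 : S ≤ 4) :
    |k.choose j * j.factorial / rf (k + c) j - vsum (c + j - 1) (k + c) j S| ≤
      vterm (c + j - 1) (k + c) j S := by
  have hk' : (6 : ℝ) ≤ k := by exact_mod_cast hk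
  have hd : 0 < k + c := by linarith
  have hF : (k.choose j : ℝ) * j.factorial / rf (k + c) j = vfull (c + j - 1) (k + c) j := by
    rw [choose_mul_factorial_eq_rf, vfull]
    congr 2
    ring
  -- For j < S the sum is complete and the omitted term is 0. Otherwise j ≥ 2, which together with c
  -- ≥ -1 makes c + j - 1 nonnegative.
  rcases lt_or_ge j S with hj | hj
  · rw [hF, vsum_eq_vfull hd hj, sub_self, abs_zero, vterm, Nat.choose_eq_zero_of_lt hj]
    simp
  have hj' : (2 : ℝ) ≤ j := by exact_mod_cast hS.trans hj
  -- The case j ≤ k + 1 is b ≤ d in the alternation lemma. Beyond it the binomial vanishes, and j ≥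
  -- k + 2 ≥ 8 ensures S ≤ 4 ≤ j / 2.
  rcases le_or_gt j (k + 1) with hjk | hjk
  · have : (j : ℝ) ≤ k + 1 := by exact_mod_cast hjk
    rw [hF]
    exact abs_vfull_sub_vsum_le (by linarith) hd (by linarith) j S
  · have : (k : ℝ) + 2 ≤ j := by exact_mod_cast hjk
    rw [Nat.choose_eq_zero_of_lt (by omega)]
    simp only [Nat.cast_zero, zero_mul, zero_div, zero_sub, abs_neg]
    exact abs_vsum_le hd (by linarith) (by omega)

-- Exponential moments of the truncated sums.

local notation "ℓ" => Real.log 2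

lemma log_two_gt : 0.6931471804 < ℓ := by
  have := abs_le.1 Real.log_two_near_10
  have h : (0.6931471804 : ℝ) < 287209 / 414355 - 1 / 10 ^ 10 := by norm_num
  linarith

lemma log_two_lt : ℓ < 0.6931471807 := by
  have := abs_le.1 Real.log_two_near_10
  have h : (287209 : ℝ) / 414355 + 1 / 10 ^ 10 < 0.6931471807 := by norm_num
  linarith

lemma log_two_pos : 0 < ℓ := by linarith [log_two_gt]

lemma log_two_lt_one : ℓ < 1 := by linarith [log_two_lt]

/-- The polynomials with `∑ₘ ℓ ^ m / m! * rf (a + m) s = 2 * pmom s a`. -/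
noncomputable def pmom : ℕ → ℝ → ℝ
  | 0, _ => 1
  | s + 1, a => a * pmom s (a + 1) + ℓ * pmom s (a + 2)

lemma hasSum_pow_div_factorial : HasSum (fun m : ℕ => ℓ ^ m / m.factorial) 2 := by
  have := NormedSpace.expSeries_div_hasSum_exp (𝔸 := ℝ) ℓ
  rwa [← Real.exp_eq_exp_ℝ, Real.exp_log (by norm_num)] at this

lemma hasSum_of_eq {f g : ℕ → ℝ} {u v : ℝ} (h : HasSum f u) (hf : ∀ j, g j = f j)
    (huv : v = u) : HasSum g v := by
  rwa [funext hf, huv]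

lemma hasSum_mul_index {g : ℕ → ℝ} {v : ℝ}
    (h : HasSum (fun m : ℕ => ℓ ^ m / m.factorial * g (m + 1)) v) :
    HasSum (fun m : ℕ => ℓ ^ m / m.factorial * (m * g m)) (ℓ * v) := by
  rw [← hasSum_nat_add_iff' 1]
  simp only [range_one, sum_singleton, Nat.cast_zero, zero_mul, mul_zero, sub_zero]
  refine hasSum_of_eq (h.mul_left ℓ) (fun m => ?_) rfl
  have : (m.factorial : ℝ) ≠ 0 := by positivity
  rw [Nat.factorial_succ]
  push_cast
  have h2 : (m : ℝ) + 1 ≠ 0 := by positivity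
  field_simp
  ring

/-- The first factor a + m of the rising factorial is split: a stays in front, while m cancels
against m! and shifts the index, producing the factor ℓ. -/
lemma hasSum_rf (s : ℕ) (a : ℝ) :
    HasSum (fun m : ℕ => ℓ ^ m / m.factorial * rf (a + m) s) (2 * pmom s a) := by
  induction s generalizing a with
  | zero => simpa [pmom] using hasSum_pow_div_factorial
  | succ s ih =>
    have h1 := (ih (a + 1)).mul_left a
    have h2 : HasSum (fun m : ℕ => ℓ ^ m / m.factorial * (m * rf (a + 1 + m) s))
        (ℓ * (2 * pmom s (a + 2))) := by
      apply hasSum_mul_index (g := fun m => rf (a + 1 + m) s)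
      refine hasSum_of_eq (ih (a + 2)) (fun m => ?_) rfl
      push_cast; ring_nf
    refine hasSum_of_eq (h1.add h2) (fun m => ?_) ?_
    · rw [rf_succ', show a + (m : ℝ) + 1 = a + 1 + m by ring]
      ring
    · rw [pmom]; ring

lemma hasSum_choose_mul (s : ℕ) (c : ℝ) :
    HasSum (fun j : ℕ => ℓ ^ j / j.factorial * (j.choose s * rf (c + j - 1) s))
      (2 * ℓ ^ s / s.factorial * pmom s (c + s - 1)) := by
  rw [← hasSum_nat_add_iff' s]
  rw [sum_eq_zero fun j hj => by rw [Nat.choose_eq_zero_of_lt (mem_range.1 hj)]; simp]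
  rw [sub_zero]
  refine hasSum_of_eq ((hasSum_rf s (c + s - 1)).mul_left (ℓ ^ s / s.factorial)) (fun m => ?_) ?_
  · have h := Nat.add_choose_mul_factorial_mul_factorial m s
    have h' : (((m + s).choose s : ℕ) : ℝ) * m.factorial * s.factorial = (m + s).factorial := by
      rw [← h]; push_cast; ring
    have h1 : (m.factorial : ℝ) ≠ 0 := by positivity
    have h2 : (s.factorial : ℝ) ≠ 0 := by positivity
    have h3 : (((m + s).choose s : ℕ) : ℝ) ≠ 0 := by
      exact_mod_cast (Nat.choose_pos (by omega)).ne'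
    rw [← h', show c + ((m + s : ℕ) : ℝ) - 1 = c + s - 1 + m by push_cast; ring, pow_add]
    field_simp
  · ring

/-- The coefficients of the expansion of `∑ⱼ C(k, j) ℓ ^ j Γ(k + c) / Γ(k + c + j)`. -/
noncomputable def cmom (s : ℕ) (c : ℝ) : ℝ := 2 * ℓ ^ s / s.factorial * pmom s (c + s - 1)

lemma hasSum_vterm (s k : ℕ) (c : ℝ) :
    HasSum (fun j : ℕ => ℓ ^ j / j.factorial * vterm (c + j - 1) (k + c) j s)
      (cmom s c / rf (k + c) s) := by
  refine hasSum_of_eq ((hasSum_choose_mul s c).div_const (rf (k + c) s)) (fun j => ?_) rfl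
  rw [vterm]; ring

lemma hasSum_vsum (S k : ℕ) (c : ℝ) :
    HasSum (fun j : ℕ => ℓ ^ j / j.factorial * vsum (c + j - 1) (k + c) j S)
      (∑ s ∈ range S, (-1) ^ s * (cmom s c / rf (k + c) s)) := by
  simp only [vsum, mul_sum]
  refine hasSum_sum fun s _ => ?_
  exact hasSum_of_eq ((hasSum_vterm s k c).mul_left ((-1) ^ s)) (fun j => by ring) rfl

lemma abs_sum_choose_sub_le {c : ℝ} {k S : ℕ} (hc : -1 ≤ c) (hk : 6 ≤ k) (hS : 2 ≤ S)
    (hS4 : S ≤ 4) :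
    |∑ j ∈ range (k + 1), k.choose j * ℓ ^ j / rf (k + c) j -
      ∑ s ∈ range S, (-1) ^ s * (cmom s c / rf (k + c) s)| ≤ cmom S c / rf (k + c) S := by
  have h0 : HasSum (fun j : ℕ => k.choose j * ℓ ^ j / rf (k + c) j)
      (∑ j ∈ range (k + 1), k.choose j * ℓ ^ j / rf (k + c) j) := by
    apply hasSum_sum_of_ne_finset_zero
    intro j hj
    rw [Nat.choose_eq_zero_of_lt (by simpa using hj)]
    simp
  have h1 := h0.sub (hasSum_vsum S k c)
  have h2 := hasSum_vterm S k c
  have hb (j : ℕ) : |k.choose j * ℓ ^ j / rf (k + c) j -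
      ℓ ^ j / j.factorial * vsum (c + j - 1) (k + c) j S| ≤
      ℓ ^ j / j.factorial * vterm (c + j - 1) (k + c) j S := by
    have hp : 0 ≤ ℓ ^ j / (j.factorial : ℝ) := by have := log_two_pos; positivity
    have hf : (j.factorial : ℝ) ≠ 0 := by positivity
    have : k.choose j * ℓ ^ j / rf (k + c) j -
        ℓ ^ j / j.factorial * vsum (c + j - 1) (k + c) j S = ℓ ^ j / j.factorial *
        (k.choose j * j.factorial / rf (k + c) j - vsum (c + j - 1) (k + c) j S) := by
      field_simp
    rw [this, abs_mul, abs_of_nonneg hp]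
    exact mul_le_mul_of_nonneg_left (abs_choose_div_sub_le hc hk hS hS4) hp
  rw [abs_le]
  constructor
  · have := hasSum_le (fun j => (abs_le.1 (hb j)).1) h2.neg h1
    exact this
  · exact hasSum_le (fun j => (abs_le.1 (hb j)).2) h1 h2

/-! ### The approximate solution of the adjoint equation and its defect. -/

/-- The first correction coefficient in `harm`. -/
noncomputable def d₁ : ℝ := ℓ * (2 + ℓ) / 2

/-- The second correction coefficient in `harm`. -/
noncomputable def d₂ : ℝ := ℓ ^ 2 * (-12 + 4 * ℓ + 3 * ℓ ^ 2) / 24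

/-- An approximate solution of `∑ⱼ C(k, j) h (k + j) = 2 h k`. -/
noncomputable def harm (n : ℕ) : ℝ :=
  ℓ ^ n / Real.Gamma (n - ℓ) * (1 + d₁ / (n - ℓ) + d₂ / ((n - ℓ) * (n - ℓ + 1)))

lemma d₁_bounds : 0.933373687 < d₁ ∧ d₁ < 0.933373688 := by
  have h1 := log_two_gt
  have h2 := log_two_lt
  rw [d₁]
  constructor <;> nlinarith

lemma d₂_bounds : -0.155869 < d₂ ∧ d₂ < -0.155867 := by
  have h1 := log_two_gt
  have h2 := log_two_lt
  have h3 : 0.4804530136 < ℓ ^ 2 := by nlinarith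
  have h4 : ℓ ^ 2 < 0.4804530143 := by nlinarith
  rw [d₂]
  constructor <;> nlinarith

lemma harm_eq {n : ℕ} (hn : 1 ≤ n) : harm n = ℓ ^ n *
    (1 / Real.Gamma (n + (-ℓ)) + d₁ / Real.Gamma (n + (1 - ℓ)) +
      d₂ / Real.Gamma (n + (2 - ℓ))) := by
  have hn' : (1 : ℝ) ≤ n := by exact_mod_cast hn
  have hx : 0 < n - ℓ := by linarith [log_two_lt_one]
  have hg := (Real.Gamma_pos_of_pos hx).ne'
  have e1 : (n : ℝ) + (1 - ℓ) = n - ℓ + 1 := by ring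
  have e2 : (n : ℝ) + (2 - ℓ) = n - ℓ + 1 + 1 := by ring
  rw [e1, e2, Real.Gamma_add_one (by linarith : n - ℓ + 1 ≠ 0), Real.Gamma_add_one hx.ne',
    ← sub_eq_add_neg, harm]
  field_simp

lemma sum_choose_harm {k : ℕ} (hk : 1 ≤ k) :
    ∑ j ∈ range (k + 1), k.choose j * harm (k + j) = ℓ ^ k / Real.Gamma (k - ℓ) *
      (∑ j ∈ range (k + 1), k.choose j * ℓ ^ j / rf (k + (-ℓ)) j +
       d₁ / (k - ℓ) * ∑ j ∈ range (k + 1), k.choose j * ℓ ^ j / rf (k + (1 - ℓ)) j +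
       d₂ / ((k - ℓ) * (k - ℓ + 1)) *
        ∑ j ∈ range (k + 1), k.choose j * ℓ ^ j / rf (k + (2 - ℓ)) j) := by
  have hk' : (1 : ℝ) ≤ k := by exact_mod_cast hk
  have hx : 0 < k - ℓ := by linarith [log_two_lt_one]
  have hg := (Real.Gamma_pos_of_pos hx).ne'
  simp only [mul_add, mul_sum, ← sum_add_distrib]
  refine sum_congr rfl fun j _ => ?_
  have e (i : ℝ) (hi : 0 ≤ i) : Real.Gamma (((k + j : ℕ) : ℝ) + (i - ℓ)) =
      Real.Gamma (k + (i - ℓ)) * rf (k + (i - ℓ)) j := by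
    rw [← Gamma_add_nat (by linarith)]
    push_cast
    ring_nf
  have e0 := e 0 le_rfl
  rw [zero_sub] at e0
  rw [harm_eq (by omega), e0, e 1 (by norm_num), e 2 (by norm_num)]
  have e1 : (k : ℝ) + (1 - ℓ) = k - ℓ + 1 := by ring
  have e2 : (k : ℝ) + (2 - ℓ) = k - ℓ + 1 + 1 := by ring
  rw [e1, e2, Real.Gamma_add_one (by linarith : k - ℓ + 1 ≠ 0), Real.Gamma_add_one hx.ne',
    ← sub_eq_add_neg]
  have h0 := (rf_pos hx j).ne'
  have h1 := (rf_pos (by linarith : 0 < k - ℓ + 1) j).ne'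
  have h2 := (rf_pos (by linarith : 0 < k - ℓ + 1 + 1) j).ne'
  field_simp
  ring

/-- These are the first omitted terms of the three expansions making up the defect of `harm`; `d₂`
is negative, so `-d₂` is its absolute value. -/
lemma cmom_bound : cmom 4 (-ℓ) + d₁ * cmom 3 (1 - ℓ) + -d₂ * cmom 2 (2 - ℓ) ≤ 17 := by
  have h4 : cmom 4 (-ℓ) = ℓ ^ 4 / 12 * (360 + 138 * ℓ + 3 * ℓ ^ 2) := by
    simp only [cmom, pmom, Nat.factorial]; push_cast; ring
  have h3 : cmom 3 (1 - ℓ) = ℓ ^ 3 / 3 * (60 + 13 * ℓ) := by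
    simp only [cmom, pmom, Nat.factorial]; push_cast; ring
  have h2 : cmom 2 (2 - ℓ) = ℓ ^ 2 * (12 + ℓ) := by
    simp only [cmom, pmom, Nat.factorial]; push_cast; ring
  have g0 := log_two_pos
  have g := log_two_lt.le
  have hd1 := d₁_bounds.2.le
  have hd2 : -d₂ ≤ 0.155869 := by linarith [d₂_bounds.1]
  rw [h4, h3, h2]
  calc _ ≤ (0.6931471807 : ℝ) ^ 4 / 12 * (360 + 138 * 0.6931471807 + 3 * 0.6931471807 ^ 2) +
        0.933373688 * (0.6931471807 ^ 3 / 3 * (60 + 13 * 0.6931471807)) +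
        0.155869 * (0.6931471807 ^ 2 * (12 + 0.6931471807)) := by gcongr
    _ ≤ 17 := by norm_num

/-- The three parts of `harm` carry prefactors of order 1, x⁻¹, x⁻², so truncating their expansions
after 4, 3 and 2 terms leaves errors of the common order x⁻⁴. -/
lemma abs_residual_le {k : ℕ} (hk : 6 ≤ k) :
    |∑ j ∈ range (k + 1), k.choose j * harm (k + j) - 2 * harm k| ≤
      17 * (ℓ ^ k / Real.Gamma (k - ℓ)) / rf (k - ℓ) 4 := by
  have hk' : (6 : ℝ) ≤ k := by exact_mod_cast hk
  have hl := log_two_lt_one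
  have hl0 := log_two_pos
  set x : ℝ := k - ℓ with hx_def
  have hx : 0 < x := by linarith
  have hg := Real.Gamma_pos_of_pos hx
  have b0 := abs_sum_choose_sub_le (c := -ℓ) (S := 4) (by linarith) hk (by norm_num) (by norm_num)
  have b1 := abs_sum_choose_sub_le (c := 1 - ℓ) (S := 3) (by linarith) hk (by norm_num)
    (by norm_num)
  have b2 := abs_sum_choose_sub_le (c := 2 - ℓ) (S := 2) (by linarith) hk (by norm_num)
    (by norm_num)
  rw [sum_choose_harm (by omega), harm]
  set A := ∑ j ∈ range (k + 1), k.choose j * ℓ ^ j / rf (k + (-ℓ)) j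
  set A1 := ∑ j ∈ range (k + 1), k.choose j * ℓ ^ j / rf (k + (1 - ℓ)) j
  set A2 := ∑ j ∈ range (k + 1), k.choose j * ℓ ^ j / rf (k + (2 - ℓ)) j
  have e0 : (k : ℝ) + (-ℓ) = x := by rw [hx_def]; ring
  have e1 : (k : ℝ) + (1 - ℓ) = x + 1 := by rw [hx_def]; ring
  have e2 : (k : ℝ) + (2 - ℓ) = x + 2 := by rw [hx_def]; ring
  rw [e0] at b0
  rw [e1] at b1
  rw [e2] at b2
  have r3 : rf x 4 = x * (x + 1) * (x + 2) * (x + 3) := by simp [rf, prod_range_succ]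
  have q0 : cmom 4 (-ℓ) / rf x 4 = cmom 4 (-ℓ) * (1 / rf x 4) := by ring
  have q1 : cmom 3 (1 - ℓ) / rf (x + 1) 3 = cmom 3 (1 - ℓ) * x * (1 / rf x 4) := by
    rw [r3]; simp [rf, prod_range_succ]; field_simp; ring
  have q2 : cmom 2 (2 - ℓ) / rf (x + 2) 2 = cmom 2 (2 - ℓ) * (x * (x + 1)) * (1 / rf x 4) := by
    rw [r3]; simp [rf, prod_range_succ]; field_simp; ring
  rw [q0] at b0
  rw [q1] at b1
  rw [q2] at b2
  -- The truncated expansions cancel exactly against twice the bracket. The shift by ℓ handles order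
  -- x⁻¹, and the values of `d₁` and `d₂` are those that handle the next two orders.
  have key : A + d₁ / x * A1 + d₂ / (x * (x + 1)) * A2 -
      2 * (1 + d₁ / x + d₂ / (x * (x + 1))) =
      (A - ∑ s ∈ range 4, (-1) ^ s * (cmom s (-ℓ) / rf x s)) +
      d₁ / x * (A1 - ∑ s ∈ range 3, (-1) ^ s * (cmom s (1 - ℓ) / rf (x + 1) s)) +
      d₂ / (x * (x + 1)) * (A2 - ∑ s ∈ range 2, (-1) ^ s * (cmom s (2 - ℓ) / rf (x + 2) s)) := by
    simp [sum_range_succ, cmom, rf, prod_range_succ, pmom, Nat.factorial]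
    rw [d₁, d₂]
    field_simp
    ring
  have e : ℓ ^ k / Real.Gamma x * (A + d₁ / x * A1 + d₂ / (x * (x + 1)) * A2) -
      2 * (ℓ ^ k / Real.Gamma x * (1 + d₁ / x + d₂ / (x * (x + 1)))) =
      ℓ ^ k / Real.Gamma x * (A + d₁ / x * A1 + d₂ / (x * (x + 1)) * A2 -
      2 * (1 + d₁ / x + d₂ / (x * (x + 1)))) := by ring
  have hp : 0 ≤ ℓ ^ k / Real.Gamma x := by positivity
  have hr : 0 < 1 / rf x 4 := by rw [r3]; positivity
  rw [e, abs_mul, abs_of_nonneg hp, key]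
  have f : 17 * (ℓ ^ k / Real.Gamma x) / rf x 4 = ℓ ^ k / Real.Gamma x * (17 * (1 / rf x 4)) := by
    ring
  rw [f]
  refine mul_le_mul_of_nonneg_left ?_ hp
  obtain ⟨hd1, hd1'⟩ := d₁_bounds
  obtain ⟨hd2, hd2'⟩ := d₂_bounds
  have c1 : |d₁ / x| = d₁ / x := abs_of_nonneg (div_nonneg (by linarith) hx.le)
  have c2 : |d₂ / (x * (x + 1))| = -d₂ / (x * (x + 1)) := by
    rw [abs_div, abs_of_nonpos (by linarith), abs_of_pos (by positivity : 0 < x * (x + 1))]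
  have t1 : |d₁ / x * (A1 - ∑ s ∈ range 3, (-1) ^ s * (cmom s (1 - ℓ) / rf (x + 1) s))| ≤
      d₁ * cmom 3 (1 - ℓ) * (1 / rf x 4) := by
    rw [abs_mul, c1]
    refine (mul_le_mul_of_nonneg_left b1 (div_nonneg (by linarith) hx.le)).trans_eq ?_
    field_simp
  have t2 : |d₂ / (x * (x + 1)) *
      (A2 - ∑ s ∈ range 2, (-1) ^ s * (cmom s (2 - ℓ) / rf (x + 2) s))| ≤
      -d₂ * cmom 2 (2 - ℓ) * (1 / rf x 4) := by
    rw [abs_mul, c2]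
    refine (mul_le_mul_of_nonneg_left b2 (div_nonneg (by linarith) (by positivity))).trans_eq ?_
    field_simp
  refine (abs_add_le _ _).trans ((add_le_add (abs_add_le _ _) le_rfl).trans ?_)
  refine (add_le_add (add_le_add b0 t1) t2).trans ?_
  rw [← add_mul, ← add_mul]
  refine mul_le_mul_of_nonneg_right ?_ hr.le
  exact cmom_bound

/-! ### The approximate invariant and its limit. -/

open Filter Topology

/-- The factor by which `harm n` differs from `ℓ ^ n / Γ(n - ℓ)`. -/
noncomputable def corr (n : ℕ) : ℝ := 1 + d₁ / (n - ℓ) + d₂ / ((n - ℓ) * (n - ℓ + 1))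

lemma harm_eq_mul_corr (n : ℕ) : harm n = ℓ ^ n / Real.Gamma (n - ℓ) * corr n := rfl

lemma sub_log_two_pos {n : ℕ} (hn : 1 ≤ n) : 0 < n - ℓ := by
  have : (1 : ℝ) ≤ n := by exact_mod_cast hn
  linarith [log_two_lt_one]

lemma one_le_corr {n : ℕ} (hn : 1 ≤ n) : 1 ≤ corr n := by
  have hx := sub_log_two_pos hn
  have : corr n = 1 + (d₁ * (n - ℓ + 1) + d₂) / ((n - ℓ) * (n - ℓ + 1)) := by
    rw [corr]; field_simp; ring
  rw [this]
  have h1 := d₁_bounds.1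
  have h2 := d₂_bounds.1
  have : 0 ≤ d₁ * (n - ℓ + 1) + d₂ := by nlinarith
  have : 0 ≤ (d₁ * (n - ℓ + 1) + d₂) / ((n - ℓ) * (n - ℓ + 1)) := by positivity
  linarith

lemma corr_le_five {n : ℕ} (hn : 1 ≤ n) : corr n ≤ 5 := by
  have hx := sub_log_two_pos hn
  have hn' : (1 : ℝ) ≤ n := by exact_mod_cast hn
  have h1 : d₁ / (n - ℓ) ≤ 4 := by
    rw [div_le_iff₀ hx]
    linarith [d₁_bounds.2, log_two_lt]
  have h2 : d₂ / ((n - ℓ) * (n - ℓ + 1)) ≤ 0 :=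
    div_nonpos_of_nonpos_of_nonneg (by linarith [d₂_bounds.2]) (by positivity)
  rw [corr]
  linarith

lemma harm_pos {n : ℕ} (hn : 1 ≤ n) : 0 < harm n := by
  have h := Real.Gamma_pos_of_pos (sub_log_two_pos hn)
  have h1 := one_le_corr hn
  have h2 := log_two_pos
  rw [harm_eq_mul_corr]
  positivity

lemma le_harm {n : ℕ} (hn : 1 ≤ n) : ℓ ^ n / Real.Gamma (n - ℓ) ≤ harm n := by
  have h := Real.Gamma_pos_of_pos (sub_log_two_pos hn)
  have h2 := log_two_pos
  rw [harm_eq_mul_corr]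
  exact le_mul_of_one_le_right (by positivity) (one_le_corr hn)

/-- The defect of `harm` at `k`. -/
noncomputable def resid (k : ℕ) : ℝ :=
  ∑ j ∈ range (k + 1), k.choose j * harm (k + j) - 2 * harm k

lemma abs_resid_le {k : ℕ} (hk : 6 ≤ k) :
    |resid k| ≤ 17 / ((k - 1) * k * (k + 1) * (k + 2)) * harm k := by
  have hk' : (6 : ℝ) ≤ k := by exact_mod_cast hk
  have h := Real.Gamma_pos_of_pos (sub_log_two_pos (by omega : 1 ≤ k))
  have h2 := log_two_pos
  have h3 := log_two_lt_one
  refine (abs_residual_le hk).trans ?_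
  rw [mul_div_assoc, mul_comm, mul_comm (17 / _)]
  have h4 : ((k : ℝ) - 1) * k * (k + 1) * (k + 2) ≤ rf (k - ℓ) 4 := by
    simp only [rf, prod_range_succ, prod_range_zero, one_mul]
    push_cast
    have e1 : (k : ℝ) - 1 ≤ k - ℓ + 0 := by linarith
    have e2 : (k : ℝ) ≤ k - ℓ + 1 := by linarith
    have e3 : (k : ℝ) + 1 ≤ k - ℓ + 2 := by linarith
    have e4 : (k : ℝ) + 2 ≤ k - ℓ + 3 := by linarith
    have e0 : (0 : ℝ) ≤ k - ℓ + 0 := by linarith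
    have e0' : (0 : ℝ) ≤ k - ℓ + 1 := by linarith
    have e0'' : (0 : ℝ) ≤ k - ℓ + 2 := by linarith
    exact mul_le_mul (mul_le_mul (mul_le_mul e1 e2 (by linarith) e0) e3 (by linarith)
      (by positivity)) e4 (by linarith) (by positivity)
  have h5 : 0 < ((k : ℝ) - 1) * k * (k + 1) * (k + 2) := by
    have : (0 : ℝ) < k - 1 := by linarith
    positivity
  calc _ = ℓ ^ k / Real.Gamma (k - ℓ) * (17 / rf (k - ℓ) 4) := by ring
    _ ≤ _ := mul_le_mul (le_harm (by omega)) (by gcongr)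
      (div_nonneg (by norm_num) (h5.le.trans h4)) (harm_pos (by omega)).le

/-- The approximate invariant of the recurrence. -/
noncomputable def invar (n : ℕ) : ℝ :=
  ∑ j ∈ range (n + 1), ∑ d ∈ range j, (n - d).choose j * harm (n - d + j) * b (n - d)

lemma sum_range_shift_sub {G : ℕ → ℝ} {n j : ℕ} (hj : j ≤ n + 1) :
    ∑ d ∈ range j, G (n + 1 - d) - ∑ d ∈ range j, G (n - d) = G (n + 1) - G (n + 1 - j) := by
  induction j with
  | zero => simp
  | succ j ih =>
    rw [sum_range_succ, sum_range_succ, show n + 1 - (j + 1) = n - j by omega]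
    linarith [ih (by omega)]

lemma sum_choose_mul_b {n : ℕ} (hn : 1 ≤ n) :
    ∑ j ∈ range (n + 1), ((n + 1 - (j + 1)).choose (j + 1) : ℝ) * b (n + 1 - (j + 1)) =
      b (n + 1) := by
  rw [b_rec (by omega), ← sum_range_reflect]
  push_cast
  refine sum_congr rfl fun k hk => ?_
  have := mem_range.1 hk
  rw [show n - (n - k) = k by omega, show n - k + 1 = n + 1 - k by omega]

lemma sum_succ_choose_harm (n : ℕ) :
    ∑ j ∈ range n, (n.choose (j + 1) : ℝ) * harm (n + (j + 1)) = harm n + resid n := by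
  rw [resid, sum_range_succ']
  simp only [Nat.choose_zero_right, Nat.cast_one, one_mul, add_zero]
  ring

/-- `invar n` sums over steps from a size k ≤ n to a size above n. Moving the cut past n + 1 adds
the steps leaving n + 1 and removes those arriving there; the latter have total weight b (n + 1) ·
harm (n + 1) by the recurrence. -/
lemma invar_succ {n : ℕ} (hn : 1 ≤ n) : invar (n + 1) = invar n + b (n + 1) * resid (n + 1) := by
  -- The added row j = n + 1 vanishes; it gives both sums the same outer range.
  have h0 : invar n = ∑ j ∈ range (n + 1 + 1), ∑ d ∈ range j,
      (n - d).choose j * harm (n - d + j) * b (n - d) := by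
    rw [sum_range_succ, ← invar, left_eq_add]
    refine sum_eq_zero fun d _ => ?_
    rw [Nat.choose_eq_zero_of_lt (by omega)]
    simp
  rw [← sub_eq_iff_eq_add', h0, invar, ← sum_sub_distrib]
  rw [sum_congr rfl fun j hj => sum_range_shift_sub
    (G := fun k => (k.choose j : ℝ) * harm (k + j) * b k) (by have := mem_range.1 hj; omega)]
  have h1 : ∑ j ∈ range (n + 1 + 1), ((n + 1 - j).choose j : ℝ) * harm (n + 1 - j + j) *
      b (n + 1 - j) = harm (n + 1) * (2 * b (n + 1)) := by
    rw [sum_range_succ', two_mul]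
    nth_rewrite 2 [← sum_choose_mul_b hn]
    rw [mul_add, mul_sum]
    simp only [Nat.sub_zero, Nat.choose_zero_right, Nat.cast_one, add_zero, one_mul]
    rw [add_comm]
    congr 1
    refine sum_congr rfl fun j hj => ?_
    have := mem_range.1 hj
    rw [Nat.sub_add_cancel (by omega)]
    ring
  rw [sum_sub_distrib, ← sum_mul, h1, resid]
  ring

lemma b_mul_harm_nonneg (n : ℕ) : 0 ≤ b n * harm n := by
  rcases Nat.eq_zero_or_pos n with rfl | hn
  · simp [b_zero]
  · exact mul_nonneg (Nat.cast_nonneg _) (harm_pos hn).le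

lemma choose_mul_harm_mul_b_nonneg (k j : ℕ) : 0 ≤ (k.choose j : ℝ) * harm (k + j) * b k := by
  rcases Nat.eq_zero_or_pos k with rfl | hk
  · simp [b_zero]
  · exact mul_nonneg (mul_nonneg (Nat.cast_nonneg _) (harm_pos (by omega)).le) (Nat.cast_nonneg _)

/-- Only the steps that start at n itself (d = 0) are kept. -/
lemma b_mul_le_invar (n : ℕ) : b n * (harm n + resid n) ≤ invar n := by
  rw [invar, sum_range_succ', ← sum_succ_choose_harm, mul_sum]
  simp only [range_zero, sum_empty, add_zero]
  refine sum_le_sum fun j _ => ?_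
  rw [sum_range_succ']
  have := sum_nonneg fun d (_ : d ∈ range j) =>
    choose_mul_harm_mul_b_nonneg (n - (d + 1)) (j + 1)
  simp only [Nat.sub_zero]
  linarith

lemma invar_nonneg (n : ℕ) : 0 ≤ invar n :=
  sum_nonneg fun j _ => sum_nonneg fun d _ => choose_mul_harm_mul_b_nonneg (n - d) j

/-- The telescoping bound for the relative variation of `invar`. -/
noncomputable def tele (k : ℕ) : ℝ := 5.9 / (k * (k + 1) * (k + 2))

/-- For n ≥ 10 the relative defect is at most 17 / (9 · 10 · 11 · 12) < 0.0015. -/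
lemma b_mul_harm_le_invar {n : ℕ} (hn : 10 ≤ n) : b n * harm n ≤ 1.002 * invar n := by
  have hn' : (10 : ℝ) ≤ n := by exact_mod_cast hn
  have h1 := (abs_le.1 (abs_resid_le (by omega : 6 ≤ n))).1
  have h2 := b_mul_le_invar n
  have h3 : 17 / (((n : ℝ) - 1) * n * (n + 1) * (n + 2)) ≤ 17 / ((10 - 1) * 10 * (10 + 1) *
    (10 + 2)) := by
    have : (0 : ℝ) ≤ n - 1 := by linarith
    gcongr
  have h4 := harm_pos (by omega : 1 ≤ n)
  have h5 := mul_le_mul_of_nonneg_right h3 h4.le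
  have h6 : harm n ≤ 1.002 * (harm n + resid n) := by
    norm_num at h5 ⊢
    linarith
  have h7 := mul_le_mul_of_nonneg_left h6 (Nat.cast_nonneg (α := ℝ) (b n))
  linarith

lemma abs_invar_sub_le {n : ℕ} (hn : 10 ≤ n) :
    |invar (n + 1) - invar n| ≤ 17.1 / (n * (n + 1) * (n + 2) * (n + 3)) * invar (n + 1) := by
  have h1 := abs_resid_le (by omega : 6 ≤ n + 1)
  have h2 := b_mul_harm_le_invar (by omega : 10 ≤ n + 1)
  rw [invar_succ (by omega : 1 ≤ n), add_sub_cancel_left, ← invar_succ (by omega : 1 ≤ n), abs_mul,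
    abs_of_nonneg (Nat.cast_nonneg (α := ℝ) _)]
  push_cast at h1
  rw [show (n : ℝ) + 1 - 1 = n by ring, show (n : ℝ) + 1 + 1 = n + 2 by ring,
    show (n : ℝ) + 1 + 2 = n + 3 by ring] at h1
  calc (b (n + 1) : ℝ) * |resid (n + 1)|
      ≤ b (n + 1) * (17 / (n * (n + 1) * (n + 2) * (n + 3)) * harm (n + 1)) := by gcongr
    _ = 17 / (n * (n + 1) * (n + 2) * (n + 3)) * (b (n + 1) * harm (n + 1)) := by ring
    _ ≤ 17 / (n * (n + 1) * (n + 2) * (n + 3)) * (1.002 * invar (n + 1)) := by gcongr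
    _ = (17 * 1.002) / (n * (n + 1) * (n + 2) * (n + 3)) * invar (n + 1) := by ring
    _ ≤ _ := by
      have := invar_nonneg (n + 1)
      gcongr
      norm_num

lemma tele_sub {n : ℕ} (hn : 1 ≤ n) :
    tele n - tele (n + 1) = 17.7 / (n * (n + 1) * (n + 2) * (n + 3)) := by
  have : (0 : ℝ) < n := by exact_mod_cast hn
  rw [tele, tele]
  push_cast
  field_simp
  ring

lemma tele_nonneg (n : ℕ) : 0 ≤ tele n := by rw [tele]; positivity

lemma tele_le {n : ℕ} (hn : 10 ≤ n) : tele n ≤ 0.005 := by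
  have hn' : (10 : ℝ) ≤ n := by exact_mod_cast hn
  calc tele n ≤ 5.9 / (10 * (10 + 1) * (10 + 2)) := by rw [tele]; gcongr
    _ ≤ _ := by norm_num

/-- The decrease of `tele` has constant 17.7 against 17.1 for the variation of `invar`; the margin
absorbs the factors 1 ± `tele n`, as `tele n` ≤ 0.005. -/
lemma invar_step {n : ℕ} (hn : 10 ≤ n) :
    invar n * (1 - tele n) ≤ invar (n + 1) * (1 - tele (n + 1)) ∧
      invar (n + 1) * (1 + tele (n + 1)) ≤ invar n * (1 + tele n) := by
  obtain ⟨h1, h2⟩ := abs_le.1 (abs_invar_sub_le hn)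
  have h3 := tele_sub (by omega : 1 ≤ n)
  have h4 := tele_nonneg n
  have h5 := tele_le hn
  have h6 := invar_nonneg (n + 1)
  set q : ℝ := 1 / (n * (n + 1) * (n + 2) * (n + 3)) with hq
  have hq0 : 0 ≤ q := by positivity
  have e1 : (17.1 : ℝ) / (n * (n + 1) * (n + 2) * (n + 3)) = 17.1 * q := by rw [hq]; ring
  have e2 : (17.7 : ℝ) / (n * (n + 1) * (n + 2) * (n + 3)) = 17.7 * q := by rw [hq]; ring
  rw [e1] at h1 h2
  rw [e2] at h3
  have e3 : tele (n + 1) = tele n - 17.7 * q := by linarith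
  rw [e3]
  have h7 := mul_nonneg hq0 h6
  have h8 := mul_nonneg h7 h4
  have h9 := mul_nonneg h7 (sub_nonneg.2 h5)
  constructor
  · have : invar n * (1 - tele n) ≤ (invar (n + 1) + 17.1 * q * invar (n + 1)) * (1 - tele n) :=
      mul_le_mul_of_nonneg_right (by linarith) (by linarith)
    linarith
  · have : (invar (n + 1) - 17.1 * q * invar (n + 1)) * (1 + tele n) ≤ invar n * (1 + tele n) :=
      mul_le_mul_of_nonneg_right (by linarith) (by linarith)
    linarith

lemma tendsto_tele : Tendsto tele atTop (𝓝 0) := by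
  have h : Tendsto (fun n : ℕ => (5.9 : ℝ) / n) atTop (𝓝 0) := tendsto_const_div_atTop_nhds_zero_nat _
  refine tendsto_of_tendsto_of_tendsto_of_le_of_le' tendsto_const_nhds h
    (Eventually.of_forall tele_nonneg) ?_
  filter_upwards [eventually_ge_atTop 1] with n hn
  have hn' : (1 : ℝ) ≤ n := by exact_mod_cast hn
  rw [tele]
  gcongr
  nlinarith [mul_nonneg (by linarith : (0 : ℝ) ≤ n) (by linarith : (0 : ℝ) ≤ n)]

lemma exists_tendsto_invar : ∃ c : ℝ, Tendsto invar atTop (𝓝 c) ∧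
    ∀ n, 10 ≤ n → invar n * (1 - tele n) ≤ c ∧ c ≤ invar n * (1 + tele n) := by
  set lo : ℕ → ℝ := fun n => invar (n + 10) * (1 - tele (n + 10))
  set hi : ℕ → ℝ := fun n => invar (n + 10) * (1 + tele (n + 10))
  have hlo : Monotone lo := monotone_nat_of_le_succ fun n => (invar_step (by omega)).1
  have hhi : Antitone hi := antitone_nat_of_succ_le fun n => (invar_step (by omega)).2
  have hle (n : ℕ) : lo n ≤ hi n := by
    have h1 := tele_nonneg (n + 10)
    have h2 := invar_nonneg (n + 10)
    exact mul_le_mul_of_nonneg_left (by linarith) h2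
  have hbdd : BddAbove (Set.range lo) :=
    ⟨hi 0, by rintro _ ⟨n, rfl⟩; exact (hle n).trans (hhi (Nat.zero_le n))⟩
  have hlim := tendsto_atTop_ciSup hlo hbdd
  set c := ⨆ n, lo n
  have ht : Tendsto (fun n => tele (n + 10)) atTop (𝓝 0) :=
    tendsto_tele.comp (tendsto_add_atTop_nat 10)
  have hinv : Tendsto (fun n => invar (n + 10)) atTop (𝓝 c) := by
    have := hlim.div (tendsto_const_nhds.sub ht : Tendsto _ _ (𝓝 ((1 : ℝ) - 0))) (by norm_num)
    rw [sub_zero, div_one] at this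
    refine this.congr fun n => ?_
    have : tele (n + 10) ≤ 0.005 := tele_le (by omega)
    simp only [lo, Pi.div_apply]
    field_simp [(by linarith : 1 - tele (n + 10) ≠ 0)]
  refine ⟨c, (tendsto_add_atTop_iff_nat 10).1 hinv, fun n hn => ?_⟩
  have hhl : Tendsto hi atTop (𝓝 c) := by
    have := hinv.mul (tendsto_const_nhds.add ht : Tendsto _ _ (𝓝 ((1 : ℝ) + 0)))
    rwa [add_zero, mul_one] at this
  obtain ⟨m, rfl⟩ := Nat.exists_eq_add_of_le' hn
  exact ⟨hlo.ge_of_tendsto hlim m, hhi.le_of_tendsto hhl m⟩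

/-! ### From convergence of the invariant to convergence of the normalised counts. -/

/-- The relative weight of `b k` in the `j`-th next term of the recurrence. -/
noncomputable def wt (k j : ℕ) : ℝ := k.choose j * harm (k + j) / harm k

lemma harm_add_div {k : ℕ} (hk : 1 ≤ k) (j : ℕ) :
    harm (k + j) / harm k = ℓ ^ j / rf (k - ℓ) j * (corr (k + j) / corr k) := by
  have hx := sub_log_two_pos hk
  have h1 := (Real.Gamma_pos_of_pos hx).ne'
  have h2 := (rf_pos hx j).ne'
  have h3 := (one_le_corr hk)
  have h4 : corr k ≠ 0 := by linarith
  have h5 := log_two_pos.ne'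
  rw [harm_eq_mul_corr, harm_eq_mul_corr,
    show ((k + j : ℕ) : ℝ) - ℓ = k - ℓ + j by push_cast; ring, Gamma_add_nat hx, pow_add]
  field_simp

lemma wt_eq {k : ℕ} (hk : 1 ≤ k) (j : ℕ) : wt k j = ℓ ^ j / j.factorial *
    (rf (k - j + 1) j / rf (k - ℓ) j) * (corr (k + j) / corr k) := by
  have h : (j.factorial : ℝ) ≠ 0 := by positivity
  rw [wt, mul_div_assoc, harm_add_div hk, ← choose_mul_factorial_eq_rf]
  field_simp

lemma wt_nonneg {j : ℕ} (hj : 1 ≤ j) (k : ℕ) : 0 ≤ wt k j := by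
  rcases Nat.eq_zero_or_pos k with rfl | hk
  · simp [wt, Nat.choose_eq_zero_of_lt hj]
  · exact div_nonneg (mul_nonneg (Nat.cast_nonneg _) (harm_pos (by omega)).le) (harm_pos hk).le

/-- Only the first factor can exceed its counterpart, by k / (k - ℓ) ≤ 1 / (1 - ℓ) < 4. -/
lemma descFactorial_le_rf {k : ℕ} (hk : 1 ≤ k) (j : ℕ) :
    (k.descFactorial j : ℝ) ≤ 4 * rf (k - ℓ) j := by
  have hx := sub_log_two_pos hk
  induction j with
  | zero => simp
  | succ j ih =>
    rw [Nat.descFactorial_succ, rf_succ, Nat.cast_mul, mul_comm]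
    rcases Nat.eq_zero_or_pos j with rfl | hj
    · have : (1 : ℝ) ≤ k := by exact_mod_cast hk
      have := log_two_lt
      simp only [Nat.sub_zero, Nat.descFactorial_zero, Nat.cast_one, rf_zero, Nat.cast_zero]
      linarith
    · have hj' : (1 : ℝ) ≤ j := by exact_mod_cast hj
      have h1 : ((k - j : ℕ) : ℝ) ≤ k - ℓ + j := by
        have : ((k - j : ℕ) : ℝ) ≤ k := by exact_mod_cast Nat.sub_le k j
        linarith [log_two_lt_one]
      rw [← mul_assoc]
      exact mul_le_mul ih h1 (Nat.cast_nonneg _) (mul_nonneg (by norm_num) (rf_pos hx j).le)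

lemma wt_le {j : ℕ} (hj : 1 ≤ j) (k : ℕ) : wt k j ≤ 20 * (ℓ ^ j / j.factorial) := by
  have hl := log_two_pos
  rcases Nat.eq_zero_or_pos k with rfl | hk
  · simp only [wt, Nat.choose_eq_zero_of_lt hj, Nat.cast_zero, zero_mul, zero_div]
    positivity
  have hx := sub_log_two_pos hk
  have h1 : rf (k - j + 1) j / rf (k - ℓ) j ≤ 4 := by
    rw [div_le_iff₀ (rf_pos hx j), ← choose_mul_factorial_eq_rf, ← Nat.cast_mul, mul_comm,
      ← Nat.descFactorial_eq_factorial_mul_choose]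
    exact descFactorial_le_rf hk j
  have h2 : corr (k + j) / corr k ≤ 5 :=
    (div_le_self (by linarith [one_le_corr (by omega : 1 ≤ k + j)]) (one_le_corr hk)).trans
      (corr_le_five (by omega))
  have h3 : 0 ≤ corr (k + j) / corr k := by
    have := one_le_corr hk
    have := one_le_corr (by omega : 1 ≤ k + j)
    positivity
  rw [wt_eq hk]
  calc _ ≤ ℓ ^ j / j.factorial * 4 * 5 := by gcongr
    _ = _ := by ring

lemma tendsto_natCast_sub (a : ℝ) : Tendsto (fun k : ℕ => (k : ℝ) + a) atTop atTop :=
  tendsto_atTop_add_const_right _ _ tendsto_natCast_atTop_atTop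

lemma tendsto_corr : Tendsto corr atTop (𝓝 1) := by
  have h1 : Tendsto (fun n : ℕ => (n : ℝ) - ℓ) atTop atTop := tendsto_natCast_sub (-ℓ)
  have h2 : Tendsto (fun n : ℕ => (n : ℝ) - ℓ + 1) atTop atTop :=
    tendsto_atTop_add_const_right _ _ h1
  have := ((h1.const_div_atTop d₁).const_add 1).add ((h1.atTop_mul_atTop₀ h2).const_div_atTop d₂)
  rwa [add_zero, add_zero] at this

lemma tendsto_add_div_add (a c : ℝ) :
    Tendsto (fun k : ℕ => ((k : ℝ) + a) / (k + c)) atTop (𝓝 1) := by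
  have h := ((tendsto_natCast_sub c).const_div_atTop (a - c)).const_add 1
  rw [add_zero] at h
  refine h.congr' ?_
  filter_upwards [(tendsto_natCast_sub c).eventually_gt_atTop 0] with k hk
  field_simp
  ring

lemma tendsto_wt (j : ℕ) : Tendsto (fun k => wt k j) atTop (𝓝 (ℓ ^ j / j.factorial)) := by
  have h1 : Tendsto (fun k : ℕ => rf (k - j + 1) j / rf (k - ℓ) j) atTop (𝓝 1) := by
    simp only [rf, ← prod_div_distrib]
    have : Tendsto (fun k : ℕ => ∏ i ∈ range j, ((k : ℝ) - j + 1 + i) / (k - ℓ + i)) atTop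
        (𝓝 (∏ i ∈ range j, 1)) := by
      refine tendsto_finsetProd _ fun i _ => ?_
      refine (tendsto_add_div_add (-j + 1 + i) (-ℓ + i)).congr fun k => ?_
      congr 1 <;> ring
    simpa using this
  have h2 : Tendsto (fun k => corr (k + j) / corr k) atTop (𝓝 1) := by
    have := (tendsto_corr.comp (tendsto_add_atTop_nat j)).div tendsto_corr one_ne_zero
    rwa [div_one] at this
  have := (h1.const_mul (ℓ ^ j / j.factorial)).mul h2
  rw [mul_one, mul_one] at this
  refine this.congr' ?_
  filter_upwards [eventually_ge_atTop 1] with k hk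
  rw [wt_eq hk]

/-- The normalised counting sequence. -/
noncomputable def nb (n : ℕ) : ℝ := b n * harm n

lemma nb_nonneg (n : ℕ) : 0 ≤ nb n := b_mul_harm_nonneg n

lemma wt_mul_nb (k j : ℕ) : wt k j * nb k = k.choose j * harm (k + j) * b k := by
  rcases Nat.eq_zero_or_pos k with rfl | hk
  · simp [nb, b_zero]
  · have := (harm_pos hk).ne'
    rw [wt, nb]
    field_simp

lemma hasSum_invar (n : ℕ) :
    HasSum (fun j => ∑ d ∈ range j, wt (n - d) j * nb (n - d)) (invar n) := by
  simp only [wt_mul_nb]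
  apply hasSum_sum_of_ne_finset_zero
  intro j hj
  refine sum_eq_zero fun d _ => ?_
  rw [Nat.choose_eq_zero_of_lt (by simp at hj; omega)]
  simp

lemma hasSum_index_mul : HasSum (fun j : ℕ => ℓ ^ j / j.factorial * (j : ℝ)) (2 * ℓ) := by
  have := hasSum_mul_index (g := fun _ => 1) (v := 2) (by simpa using hasSum_pow_div_factorial)
  simpa [mul_comm] using this

lemma exists_nb_le : ∃ C : ℝ, 0 < C ∧ ∀ n, nb n ≤ C := by
  obtain ⟨c, hc, -⟩ := exists_tendsto_invar
  obtain ⟨A, hA⟩ := hc.bddAbove_range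
  refine ⟨∑ n ∈ range 10, nb n + 1.002 * |A| + 1, ?_, fun n => ?_⟩
  · have := sum_nonneg fun n (_ : n ∈ range 10) => nb_nonneg n
    positivity
  · rcases lt_or_ge n 10 with hn | hn
    · have := single_le_sum (f := nb) (fun n _ => nb_nonneg n) (mem_range.2 hn)
      have := abs_nonneg A
      linarith
    · have h1 := b_mul_harm_le_invar hn
      have h2 : invar n ≤ A := hA ⟨n, rfl⟩
      have h3 := le_abs_self A
      have := sum_nonneg fun n (_ : n ∈ range 10) => nb_nonneg n
      rw [nb]
      linarith

lemma tendsto_sub_nat (d : ℕ) : Tendsto (fun n : ℕ => n - d) atTop atTop :=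
  tendsto_sub_atTop_nat d

/-- Dominated convergence for the double sums over `d < j`. -/
lemma tendsto_tsum_range {f : ℕ → ℕ → ℕ → ℝ} {g : ℕ → ℕ → ℝ} {C : ℝ}
    (hf : ∀ j d, d < j → Tendsto (fun n => f n j d) atTop (𝓝 (g j d)))
    (hb : ∀ n j d, d < j → |f n j d| ≤ C * (ℓ ^ j / j.factorial)) :
    Tendsto (fun n => ∑' j, ∑ d ∈ range j, f n j d) atTop (𝓝 (∑' j, ∑ d ∈ range j, g j d)) := by
  refine tendsto_tsum_of_dominated_convergence
    (bound := fun j : ℕ => C * (ℓ ^ j / j.factorial * (j : ℝ))) (hasSum_index_mul.summable.mul_left C)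
    (fun j => tendsto_finsetSum _ fun d hd => hf j d (mem_range.1 hd))
    (Eventually.of_forall fun n j => ?_)
  rw [Real.norm_eq_abs]
  refine (abs_sum_le_sum_abs _ _).trans ?_
  refine (sum_le_sum fun d hd => hb n j d (mem_range.1 hd)).trans_eq ?_
  rw [sum_const, card_range, nsmul_eq_mul]
  ring

lemma summable_range {f : ℕ → ℕ → ℝ} {C : ℝ}
    (hb : ∀ j d, d < j → |f j d| ≤ C * (ℓ ^ j / j.factorial)) :
    Summable fun j => ∑ d ∈ range j, f j d := by
  refine Summable.of_norm_bounded (hasSum_index_mul.summable.mul_left C) fun j => ?_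
  rw [Real.norm_eq_abs]
  refine (abs_sum_le_sum_abs _ _).trans ?_
  refine (sum_le_sum fun d hd => hb j d (mem_range.1 hd)).trans_eq ?_
  rw [sum_const, card_range, nsmul_eq_mul]
  ring

lemma weight_nonneg (j : ℕ) : 0 ≤ ℓ ^ j / (j.factorial : ℝ) := by
  have := log_two_pos
  positivity

lemma tsum_range_const (c : ℝ) :
    ∑' j : ℕ, ∑ _d ∈ range j, ℓ ^ j / (j.factorial : ℝ) * c = 2 * ℓ * c := by
  rw [← (hasSum_index_mul.mul_right c).tsum_eq]
  refine tsum_congr fun j => ?_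
  rw [sum_const, card_range, nsmul_eq_mul]
  ring

/-- By dominated convergence, the weights in `invar` may be replaced by their limits ℓ^j / j!,
because `nb` is bounded; the constant c then contributes 2ℓc. -/
lemma tendsto_tsum_nb_sub {c : ℝ} (hc : Tendsto invar atTop (𝓝 (2 * ℓ * c))) :
    Tendsto (fun n => ∑' j : ℕ, ∑ d ∈ range j, ℓ ^ j / (j.factorial : ℝ) * (nb (n - d) - c))
      atTop (𝓝 0) := by
  obtain ⟨C, hC0, hC⟩ := exists_nb_le
  have hw0 (j : ℕ) := weight_nonneg j
  have h1 : Tendsto (fun n => ∑' j : ℕ, ∑ d ∈ range j,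
      (ℓ ^ j / (j.factorial : ℝ) - wt (n - d) j) * nb (n - d)) atTop
      (𝓝 (∑' j : ℕ, ∑ d ∈ range j, (0 : ℝ))) := by
    refine tendsto_tsum_range (C := 20 * C) (fun j d hd => ?_) fun n j d hd => ?_
    · have h2 := tendsto_const_nhds.sub ((tendsto_wt j).comp (tendsto_sub_nat d))
        (a := ℓ ^ j / (j.factorial : ℝ))
      rw [sub_self] at h2
      refine squeeze_zero_norm (a := fun n => |ℓ ^ j / (j.factorial : ℝ) - wt (n - d) j| * C)
        (fun n => ?_) ?_
      · rw [Real.norm_eq_abs, abs_mul, abs_of_nonneg (nb_nonneg _)]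
        exact mul_le_mul_of_nonneg_left (hC _) (abs_nonneg _)
      · have := h2.abs.mul_const C
        rwa [abs_zero, zero_mul] at this
    · have h3 := wt_le (by omega : 1 ≤ j) (n - d)
      have h4 := wt_nonneg (by omega : 1 ≤ j) (n - d)
      have h5 : |ℓ ^ j / (j.factorial : ℝ) - wt (n - d) j| ≤ 20 * (ℓ ^ j / j.factorial) := by
        rw [abs_le]
        constructor <;> linarith [hw0 j]
      rw [abs_mul, abs_of_nonneg (nb_nonneg _)]
      calc _ ≤ 20 * (ℓ ^ j / (j.factorial : ℝ)) * C :=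
            mul_le_mul h5 (hC _) (nb_nonneg _) (by linarith [hw0 j])
        _ = _ := by ring
  simp only [sum_const_zero, tsum_zero] at h1
  have h2 := (h1.add hc).sub_const (2 * ℓ * c)
  rw [zero_add, sub_self] at h2
  refine h2.congr fun n => ?_
  have s1 : Summable fun j : ℕ => ∑ d ∈ range j, ℓ ^ j / (j.factorial : ℝ) * nb (n - d) :=
    summable_range (C := C) fun j d _ => by
      rw [abs_mul, abs_of_nonneg (hw0 j), abs_of_nonneg (nb_nonneg _), mul_comm]
      exact mul_le_mul_of_nonneg_right (hC _) (hw0 j)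
  have s2 : Summable fun j : ℕ => ∑ d ∈ range j, ℓ ^ j / (j.factorial : ℝ) * c :=
    summable_range (C := |c|) fun j d _ => by
      rw [abs_mul, abs_of_nonneg (hw0 j), mul_comm]
  have s3 := (hasSum_invar n)
  simp only [sub_mul, mul_sub, sum_sub_distrib]
  rw [s1.tsum_sub s3.summable, s1.tsum_sub s2, s3.tsum_eq, tsum_range_const]
  ring

/-- The terms with d = 0 have total weight ∑_{j ≥ 1} ℓ^j / j! = e^ℓ - 1 = 1. -/
lemma tsum_range_eq_add {v : ℕ → ℝ} {C : ℝ} (hv : ∀ n, |v n| ≤ C) (n : ℕ) :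
    ∑' j : ℕ, ∑ d ∈ range j, ℓ ^ j / (j.factorial : ℝ) * v (n - d) =
      v n + ∑' j : ℕ, ∑ d ∈ range j, if 1 ≤ d then ℓ ^ j / (j.factorial : ℝ) * v (n - d) else 0 := by
  have hw0 (j : ℕ) := weight_nonneg j
  have hC : 0 ≤ C := (abs_nonneg _).trans (hv 0)
  have h1 : HasSum (fun j : ℕ => if j = 0 then 0 else ℓ ^ j / (j.factorial : ℝ) * v n) (v n) := by
    have := ((hasSum_nat_add_iff' 1).2 hasSum_pow_div_factorial).mul_right (v n)
    rw [← hasSum_nat_add_iff' 1]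
    norm_num at this ⊢
    exact this
  have s : Summable fun j : ℕ => ∑ d ∈ range j,
      if 1 ≤ d then ℓ ^ j / (j.factorial : ℝ) * v (n - d) else 0 :=
    summable_range (C := C) fun j d _ => by
      split_ifs
      · rw [abs_mul, abs_of_nonneg (hw0 j), mul_comm]
        exact mul_le_mul_of_nonneg_right (hv _) (hw0 j)
      · rw [abs_zero]
        exact mul_nonneg hC (hw0 j)
  rw [← h1.tsum_eq, ← h1.summable.tsum_add s]
  refine tsum_congr fun j => ?_
  cases j with
  | zero => simp
  | succ j =>
    rw [sum_range_succ', sum_range_succ' (n := j)]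
    simp [add_comm]

/-- The current value has weight 1 and the past has weight 2ℓ - 1 < 1/2, so an eventual bound on |v|
can be halved repeatedly. -/
lemma tendsto_zero_of_tsum {v : ℕ → ℝ} {C : ℝ} (hv : ∀ n, |v n| ≤ C)
    (h : Tendsto (fun n => ∑' j : ℕ, ∑ d ∈ range j, ℓ ^ j / (j.factorial : ℝ) * v (n - d))
      atTop (𝓝 0)) : Tendsto v atTop (𝓝 0) := by
  have hw0 (j : ℕ) := weight_nonneg j
  have hC : 0 ≤ C := (abs_nonneg _).trans (hv 0)
  have half (M : ℝ) (hM0 : 0 < M) (hM : ∀ᶠ n in atTop, |v n| ≤ M) :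
      ∀ᶠ n in atTop, |v n| ≤ M / 2 := by
    -- The bound M holds only eventually, and for fixed n the sum reaches back to early indices. The
    -- maximum with M dominates |v| everywhere and still tends to M termwise.
    set F : ℕ → ℕ → ℕ → ℝ := fun n j d =>
      if 1 ≤ d then ℓ ^ j / (j.factorial : ℝ) * max |v (n - d)| M else 0
    have hF : Tendsto (fun n => ∑' j, ∑ d ∈ range j, F n j d) atTop (𝓝 (∑' j : ℕ, ∑ d ∈ range j,
        if 1 ≤ d then ℓ ^ j / (j.factorial : ℝ) * M else 0)) := by
      refine tendsto_tsum_range (C := max C M) (fun j d _ => ?_) fun n j d _ => ?_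
      · simp only [F]
        split_ifs
        · refine tendsto_const_nhds.congr' ?_
          filter_upwards [(tendsto_sub_nat d).eventually hM] with n hn
          rw [max_eq_right hn]
        · exact tendsto_const_nhds
      · simp only [F]
        split_ifs
        · rw [abs_mul, abs_of_nonneg (hw0 j), mul_comm, abs_of_nonneg (le_max_of_le_left
            (abs_nonneg _))]
          exact mul_le_mul_of_nonneg_right (max_le_max_right _ (hv _)) (hw0 j)
        · rw [abs_zero]
          exact mul_nonneg (le_max_of_le_left hC) (hw0 j)
    have e := tsum_range_eq_add (v := fun _ => M) (C := |M|) (fun _ => le_rfl) 0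
    rw [tsum_range_const] at e
    -- The value is (2ℓ - 1) M ≈ 0.386 M; 0.45 and 0.05 below add up to the desired 1/2.
    have hlt : (∑' j : ℕ, ∑ d ∈ range j, if 1 ≤ d then ℓ ^ j / (j.factorial : ℝ) * M else 0) <
        0.45 * M := by
      have := mul_lt_mul_of_pos_right log_two_lt hM0
      linarith
    have h0 : ∀ᶠ n in atTop, |∑' j : ℕ, ∑ d ∈ range j, ℓ ^ j / (j.factorial : ℝ) * v (n - d)| <
        0.05 * M := by
      have := h.abs
      rw [abs_zero] at this
      exact this.eventually_lt_const (by positivity)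
    filter_upwards [hF.eventually_lt_const hlt, h0] with n h1 h2
    rw [tsum_range_eq_add hv] at h2
    have s1 : Summable fun j => ∑ d ∈ range j, F n j d :=
      summable_range (C := max C M) fun j d _ => by
        simp only [F]
        split_ifs
        · rw [abs_mul, abs_of_nonneg (hw0 j), mul_comm, abs_of_nonneg (le_max_of_le_left
            (abs_nonneg _))]
          exact mul_le_mul_of_nonneg_right (max_le_max_right _ (hv _)) (hw0 j)
        · rw [abs_zero]
          exact mul_nonneg (le_max_of_le_left hC) (hw0 j)
    have h3 : |∑' j : ℕ, ∑ d ∈ range j, if 1 ≤ d then ℓ ^ j / (j.factorial : ℝ) * v (n - d)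
        else 0| ≤ ∑' j, ∑ d ∈ range j, F n j d := by
      rw [← Real.norm_eq_abs]
      refine tsum_of_norm_bounded s1.hasSum fun j => ?_
      rw [Real.norm_eq_abs]
      refine (abs_sum_le_sum_abs _ _).trans (sum_le_sum fun d _ => ?_)
      simp only [F]
      split_ifs
      · rw [abs_mul, abs_of_nonneg (hw0 j)]
        exact mul_le_mul_of_nonneg_left (le_max_left _ _) (hw0 j)
      · simp
    have h4 := abs_lt.1 h2
    have h5 := abs_le.1 h3
    rw [abs_le]
    constructor <;> linarith
  have iter (m : ℕ) : ∀ᶠ n in atTop, |v n| ≤ (C + 1) * (1 / 2) ^ m := by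
    induction m with
    | zero => exact Eventually.of_forall fun n => by linarith [hv n]
    | succ m ih =>
      have := half _ (by positivity) ih
      filter_upwards [this] with n hn
      rw [pow_succ]
      linarith
  rw [tendsto_zero_iff_abs_tendsto_zero]
  refine tendsto_order.2 ⟨fun a ha => Eventually.of_forall fun n => ha.trans_le (abs_nonneg _),
    fun a ha => ?_⟩
  have : Tendsto (fun m : ℕ => (C + 1) * (1 / 2 : ℝ) ^ m) atTop (𝓝 ((C + 1) * 0)) :=
    (tendsto_pow_atTop_nhds_zero_of_lt_one (by norm_num) (by norm_num)).const_mul _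
  rw [mul_zero] at this
  obtain ⟨m, hm⟩ := (this.eventually_lt_const ha).exists
  filter_upwards [iter m] with n hn
  exact hn.trans_lt hm

lemma tendsto_nb {c : ℝ} (hc : Tendsto invar atTop (𝓝 (2 * ℓ * c))) :
    Tendsto nb atTop (𝓝 c) := by
  obtain ⟨C, hC0, hC⟩ := exists_nb_le
  have := tendsto_zero_of_tsum (v := fun n => nb n - c) (C := C + |c|) (fun n => ?_)
    (tendsto_tsum_nb_sub hc)
  · have := this.add_const c
    simpa using this
  · refine (abs_sub _ _).trans ?_
    rw [abs_of_nonneg (nb_nonneg n)]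
    linarith [hC n]

/-! ### Asymptotics of Γ(n - ℓ) / Γ(n) with explicit error. -/

/-- The ratio of `Γ(n - ℓ)` to its leading asymptotics. -/
noncomputable def gratio (n : ℕ) : ℝ := Real.Gamma (n - ℓ) * (n : ℝ) ^ ℓ / Real.Gamma n

lemma gratio_pos {n : ℕ} (hn : 1 ≤ n) : 0 < gratio n := by
  have h0 : (0 : ℝ) < n := by exact_mod_cast hn
  have h1 := Real.Gamma_pos_of_pos (sub_log_two_pos hn)
  have h2 := Real.Gamma_pos_of_pos h0
  rw [gratio]
  positivity

/-- This is Euler's limit formula for Γ(1 - ℓ), rewritten through the functional equation. -/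
lemma tendsto_gratio : Tendsto gratio atTop (𝓝 1) := by
  have hs : 0 < 1 - ℓ := by linarith [log_two_lt_one]
  have hG := Real.Gamma_pos_of_pos hs
  have h1 := (Real.GammaSeq_tendsto_Gamma (1 - ℓ)).div_const (Real.Gamma (1 - ℓ))
  rw [div_self hG.ne'] at h1
  have h2 := (tendsto_add_div_add 0 (1 - ℓ)).mul (tendsto_add_div_add 0 (-ℓ))
  have h3 := h2.div h1 one_ne_zero
  simp only [mul_one, div_one] at h3
  refine h3.congr' ?_
  filter_upwards [eventually_ge_atTop 1] with n hn
  have h0 : (0 : ℝ) < n := by exact_mod_cast hn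
  have hx := sub_log_two_pos hn
  have hg := Real.Gamma_pos_of_pos hx
  have e1 : ∏ j ∈ range (n + 1), (1 - ℓ + j) = rf (1 - ℓ) (n + 1) := rfl
  have e2 : Real.Gamma (1 - ℓ) * rf (1 - ℓ) (n + 1) =
      (n - ℓ + 1) * ((n - ℓ) * Real.Gamma (n - ℓ)) := by
    rw [← Gamma_add_nat hs, ← Real.Gamma_add_one hx.ne', ← Real.Gamma_add_one (by linarith)]
    congr 1
    push_cast
    ring
  have e3 : rf (1 - ℓ) (n + 1) = (n - ℓ + 1) * ((n - ℓ) * Real.Gamma (n - ℓ)) /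
      Real.Gamma (1 - ℓ) := by rw [← e2]; field_simp
  have e4 : (n.factorial : ℝ) = n * Real.Gamma n := by
    rw [← Real.Gamma_add_one h0.ne', Real.Gamma_nat_eq_factorial]
  have e5 : (n : ℝ) ^ (1 - ℓ) = n / (n : ℝ) ^ ℓ := by
    rw [Real.rpow_sub h0, Real.rpow_one]
  have h5 : 0 < (n : ℝ) ^ ℓ := by positivity
  have h6 := Real.Gamma_pos_of_pos h0
  have h7 : (n : ℝ) + (1 - ℓ) ≠ 0 := by linarith
  have h8 : (n : ℝ) + -ℓ ≠ 0 := by linarith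
  have h9 : (n : ℝ) - ℓ + 1 ≠ 0 := by linarith
  simp only [Pi.div_apply]
  rw [Real.GammaSeq, e1, e3, e4, e5, gratio, add_zero,
    show (n : ℝ) + (1 - ℓ) = n - ℓ + 1 by ring, ← sub_eq_add_neg]
  field_simp

/-- The approximation `log (gratio n) ≈ a₁ / n + a₂ / n ^ 2`, with a correction of size `κ / n ^ 3`. -/
noncomputable def lgApprox (κ : ℝ) (n : ℕ) : ℝ :=
  (ℓ + ℓ ^ 2) / 2 / n + (ℓ / 12 + ℓ ^ 2 / 4 + ℓ ^ 3 / 6) / n ^ 2 + κ / n ^ 3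

lemma log_gratio_sub {n : ℕ} (hn : 1 ≤ n) :
    Real.log (gratio n) - Real.log (gratio (n + 1)) =
      -Real.log (1 - ℓ / n) - ℓ * Real.log (1 + 1 / n) := by
  have h0 : (0 : ℝ) < n := by exact_mod_cast hn
  have hx := sub_log_two_pos hn
  have hg := Real.Gamma_pos_of_pos hx
  have hg' := Real.Gamma_pos_of_pos h0
  have h1 : 0 < 1 - ℓ / n := by
    rw [sub_pos, div_lt_one h0]; linarith
  have h2 : (0 : ℝ) < 1 + 1 / n := by positivity
  have e : gratio (n + 1) = gratio n * (1 - ℓ / n) * (1 + 1 / n) ^ ℓ := by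
    rw [gratio, gratio]
    push_cast
    rw [show (n : ℝ) + 1 - ℓ = n - ℓ + 1 by ring, Real.Gamma_add_one hx.ne',
      Real.Gamma_add_one h0.ne', show (n : ℝ) + 1 = n * (1 + 1 / n) by field_simp,
      Real.mul_rpow h0.le h2.le]
    field_simp
  rw [e, Real.log_mul (mul_pos (gratio_pos hn) h1).ne' (by positivity),
    Real.log_mul (gratio_pos hn).ne' h1.ne', Real.log_rpow h2]
  ring

/-- With y = 1/n, the coefficients of `lgApprox` are those for which the increments agree in orders
y² and y³. -/
lemma abs_log_gratio_sub_le {n : ℕ} (hn : 100 ≤ n) :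
    |Real.log (gratio n) - Real.log (gratio (n + 1)) - (lgApprox 0 n - lgApprox 0 (n + 1))| ≤
      2 / n ^ 4 := by
  have hn' : (100 : ℝ) ≤ n := by exact_mod_cast hn
  have h0 : (0 : ℝ) < n := by linarith
  have g1 := log_two_gt
  have g2 := log_two_lt
  have g0 := log_two_pos
  rw [log_gratio_sub (by omega)]
  set y : ℝ := 1 / n with hy
  have hy0 : 0 < y := by positivity
  have hy1 : y ≤ 0.01 := by rw [hy, div_le_iff₀ h0]; linarith
  have b1 := Real.abs_log_sub_add_sum_range_le (x := ℓ * y)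
    (by rw [abs_of_pos (by positivity)]; nlinarith) 3
  have b2 := Real.abs_log_sub_add_sum_range_le (x := -y)
    (by rw [abs_neg, abs_of_pos hy0]; linarith) 3
  rw [abs_neg, abs_of_pos hy0] at b2
  rw [abs_of_pos (by positivity : 0 < ℓ * y)] at b1
  simp only [sum_range_succ, sum_range_zero] at b1 b2
  norm_num at b1 b2
  have c1 : (ℓ * y) ^ 4 / (1 - ℓ * y) ≤ 0.25 * y ^ 4 := by
    have h : 0.99 ≤ 1 - ℓ * y := by nlinarith
    have h4 : ℓ ^ 4 ≤ 0.6931471807 ^ 4 := by gcongr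
    rw [div_le_iff₀ (by linarith), mul_pow]
    have hy4 : 0 < y ^ 4 := by positivity
    calc ℓ ^ 4 * y ^ 4 ≤ (0.25 * 0.99) * y ^ 4 := by
          apply mul_le_mul_of_nonneg_right _ hy4.le
          exact h4.trans (by norm_num)
      _ ≤ 0.25 * y ^ 4 * (1 - ℓ * y) := by nlinarith
  have c2 : y ^ 4 / (1 - y) ≤ 1.02 * y ^ 4 := by
    have hy4 : 0 < y ^ 4 := by positivity
    rw [div_le_iff₀ (by linarith)]
    nlinarith
  have e : lgApprox 0 n - lgApprox 0 (n + 1) = (ℓ + ℓ ^ 2) / 2 * y ^ 2 + (ℓ ^ 3 - ℓ) / 3 * y ^ 3 +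
      ((ℓ + ℓ ^ 2) / 2 * (n + 1) - (ℓ / 12 + ℓ ^ 2 / 4 + ℓ ^ 3 / 6) * (3 * n + 2)) /
        (n ^ 3 * (n + 1) ^ 2) := by
    rw [lgApprox, lgApprox, hy]
    push_cast
    field_simp
    ring
  have l2 : ℓ ^ 2 < 0.4805 := by nlinarith
  have l2' : 0.4804 < ℓ ^ 2 := by nlinarith
  have l3 : ℓ ^ 3 < 0.3331 := by nlinarith
  have l3' : 0.3329 < ℓ ^ 3 := by nlinarith
  have c3 : |((ℓ + ℓ ^ 2) / 2 * (n + 1) - (ℓ / 12 + ℓ ^ 2 / 4 + ℓ ^ 3 / 6) * (3 * n + 2)) /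
        ((n : ℝ) ^ 3 * (n + 1) ^ 2)| ≤ 0.5 * y ^ 4 := by
    have hd : (0 : ℝ) < (n : ℝ) ^ 3 * (n + 1) ^ 2 := by positivity
    have hA : |(ℓ + ℓ ^ 2) / 2 * ((n : ℝ) + 1) - (ℓ / 12 + ℓ ^ 2 / 4 + ℓ ^ 3 / 6) * (3 * n + 2)| ≤
        0.5 * ((n : ℝ) + 1) := by
      have u1 : ℓ / 12 + ℓ ^ 2 / 4 + ℓ ^ 3 / 6 ≤ 0.234 := by linarith
      have u2 : 0.23 ≤ ℓ / 12 + ℓ ^ 2 / 4 + ℓ ^ 3 / 6 := by linarith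
      have u3 : 0.586 ≤ (ℓ + ℓ ^ 2) / 2 := by linarith
      have u4 : (ℓ + ℓ ^ 2) / 2 ≤ 0.588 := by linarith
      have h1 : (0 : ℝ) ≤ n + 1 := by linarith
      have h2 : (0 : ℝ) ≤ 3 * n + 2 := by linarith
      have v1 := mul_le_mul_of_nonneg_right u1 h2
      have v2 := mul_le_mul_of_nonneg_right u2 h2
      have v3 := mul_le_mul_of_nonneg_right u3 h1
      have v4 := mul_le_mul_of_nonneg_right u4 h1
      rw [abs_le]
      constructor <;> linarith
    rw [abs_div, abs_of_pos hd, div_le_iff₀ hd]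
    refine hA.trans ?_
    rw [hy]
    have : 0.5 * (1 / (n : ℝ)) ^ 4 * (n ^ 3 * (n + 1) ^ 2) = 0.5 * (n + 1) * ((n + 1) / n) := by
      field_simp
    rw [this]
    have h2 : 1 ≤ ((n : ℝ) + 1) / n := by rw [le_div_iff₀ h0]; linarith
    exact le_mul_of_one_le_right (by positivity) h2
  have e2 : 2 / (n : ℝ) ^ 4 = 2 * y ^ 4 := by rw [hy]; field_simp
  have e3 : ℓ / (n : ℝ) = ℓ * y := by rw [hy]; ring
  rw [e, e2, e3]
  obtain ⟨p1, p2⟩ := abs_le.1 b1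
  obtain ⟨q1, q2⟩ := abs_le.1 b2
  obtain ⟨r1, r2⟩ := abs_le.1 c3
  have hy4 : 0 < y ^ 4 := by positivity
  set P := Real.log (1 - ℓ * y)
  set Q := Real.log (1 + y)
  have s1 := mul_le_mul_of_nonneg_left q1 g0.le
  have s2 := mul_le_mul_of_nonneg_left q2 g0.le
  have s3 : ℓ * (y ^ 4 / (1 - y)) ≤ 0.72 * y ^ 4 := by
    have h1 := mul_le_mul_of_nonneg_left c2 g0.le
    have h2 := mul_le_mul_of_nonneg_right g2.le hy4.le
    linarith
  rw [abs_le]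
  constructor <;> linarith

lemma lgApprox_sub (κ : ℝ) (n : ℕ) : lgApprox κ n = lgApprox 0 n + κ / n ^ 3 := by
  rw [lgApprox, lgApprox, zero_div, add_zero]

lemma inv_cube_sub_ge {n : ℕ} (hn : 100 ≤ n) :
    2 / (n : ℝ) ^ 4 ≤ 1 / (n : ℝ) ^ 3 - 1 / ((n + 1 : ℕ) : ℝ) ^ 3 := by
  have hn' : (100 : ℝ) ≤ n := by exact_mod_cast hn
  have h0 : (0 : ℝ) < n := by linarith
  push_cast
  have e : 1 / (n : ℝ) ^ 3 - 1 / ((n : ℝ) + 1) ^ 3 - 2 / (n : ℝ) ^ 4 =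
      ((n : ℝ) ^ 2 * (n - 3) - 5 * n - 2) / (n ^ 4 * (n + 1) ^ 3) := by
    field_simp
    ring
  have : 0 ≤ ((n : ℝ) ^ 2 * (n - 3) - 5 * n - 2) / (n ^ 4 * (n + 1) ^ 3) := by
    apply div_nonneg _ (by positivity)
    nlinarith [mul_nonneg (mul_nonneg h0.le h0.le) (by linarith : (0 : ℝ) ≤ n - 4)]
  linarith

lemma tendsto_lgApprox (κ : ℝ) : Tendsto (lgApprox κ) atTop (𝓝 0) := by
  have h : Tendsto (fun n : ℕ => (n : ℝ)) atTop atTop := tendsto_natCast_atTop_atTop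
  have h2 := (tendsto_pow_atTop (α := ℝ) two_ne_zero).comp h
  have h3 := (tendsto_pow_atTop (α := ℝ) three_ne_zero).comp h
  have := ((h.const_div_atTop ((ℓ + ℓ ^ 2) / 2)).add
    (h2.const_div_atTop (ℓ / 12 + ℓ ^ 2 / 4 + ℓ ^ 3 / 6))).add (h3.const_div_atTop κ)
  rw [add_zero, add_zero] at this
  exact this

/-- The term ±1/n³ outweighs the increment error 2/n⁴, so the differences from log `gratio` are
monotone; they tend to 0, which fixes their signs. -/
lemma log_gratio_mem {n : ℕ} (hn : 100 ≤ n) :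
    lgApprox (-1) n ≤ Real.log (gratio n) ∧ Real.log (gratio n) ≤ lgApprox 1 n := by
  have hlog : Tendsto (fun n => Real.log (gratio n)) atTop (𝓝 0) := by
    have := tendsto_gratio.log one_ne_zero
    rwa [Real.log_one] at this
  have step (m : ℕ) (hm : 100 ≤ m) := abs_le.1 (abs_log_gratio_sub_le hm)
  obtain ⟨m, rfl⟩ := Nat.exists_eq_add_of_le' hn
  constructor
  · have hanti : Antitone fun m => Real.log (gratio (m + 100)) - lgApprox (-1) (m + 100) := by
      refine antitone_nat_of_succ_le fun m => ?_
      have h1 := (step (m + 100) (by omega)).1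
      have h2 := inv_cube_sub_ge (by omega : 100 ≤ m + 100)
      rw [show m + 1 + 100 = m + 100 + 1 by ring, lgApprox_sub (-1) (m + 100),
        lgApprox_sub (-1) (m + 100 + 1), neg_div, neg_div]
      linarith
    have hlim := (hlog.sub (tendsto_lgApprox (-1))).comp (tendsto_add_atTop_nat 100)
    rw [sub_zero] at hlim
    have := hanti.le_of_tendsto hlim m
    linarith
  · have hmono : Monotone fun m => Real.log (gratio (m + 100)) - lgApprox 1 (m + 100) := by
      refine monotone_nat_of_le_succ fun m => ?_
      have h1 := (step (m + 100) (by omega)).2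
      have h2 := inv_cube_sub_ge (by omega : 100 ≤ m + 100)
      rw [show m + 1 + 100 = m + 100 + 1 by ring, lgApprox_sub 1 (m + 100),
        lgApprox_sub 1 (m + 100 + 1)]
      linarith
    have hlim := (hlog.sub (tendsto_lgApprox 1)).comp (tendsto_add_atTop_nat 100)
    rw [sub_zero] at hlim
    have := hmono.ge_of_tendsto hlim m
    linarith

/-! ### Evaluation of the invariant in integer arithmetic. -/

/-- The contribution of the trees with at most `n` leaves to `b i`. -/
def contrib (n i : ℕ) : ℕ := ∑ k ∈ range (n + 1), k.choose (i - k) * b k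

lemma contrib_succ (n i : ℕ) :
    contrib (n + 1) i = contrib n i + b (n + 1) * (n + 1).choose (i - (n + 1)) := by
  rw [contrib, sum_range_succ, ← contrib, mul_comm (b (n + 1))]

lemma contrib_self {n : ℕ} (hn : 1 ≤ n) : contrib n (n + 1) = b (n + 1) :=
  (b_rec (by omega)).symm

lemma contrib_eq_zero {n i : ℕ} (h : 2 * n < i) : contrib n i = 0 := by
  refine sum_eq_zero fun k hk => ?_
  have := mem_range.1 hk
  rw [Nat.choose_eq_zero_of_lt (by omega), zero_mul]

/-- The flux is regrouped by its target i = n + 1 + m; since i ≤ 2n, only m < n matters. -/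
lemma invar_eq_sum_contrib (n : ℕ) :
    invar n = ∑ m ∈ range n, (contrib n (n + 1 + m) : ℝ) * harm (n + 1 + m) := by
  have h1 : invar n = ∑ d ∈ range (n + 1), ∑ j ∈ range (n + 1),
      if d < j then (n - d).choose j * harm (n - d + j) * b (n - d) else 0 := by
    rw [sum_comm, invar]
    refine sum_congr rfl fun j hj => ?_
    have := mem_range.1 hj
    rw [← sum_filter]
    congr 1
    ext d
    simp only [mem_range, mem_filter]
    omega
  rw [h1, ← sum_range_reflect]
  simp only [contrib, Nat.cast_sum, sum_mul]
  rw [sum_comm (s := range n)]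
  refine sum_congr rfl fun k hk => ?_
  have hk' := mem_range.1 hk
  rw [show n - (n + 1 - 1 - k) = k by omega, ← sum_filter]
  have e : ∀ m, ((k.choose (n + 1 + m - k) * b k : ℕ) : ℝ) * harm (n + 1 + m) =
      (fun j => (k.choose j : ℝ) * harm (k + j) * b k) (n + 1 - k + m) := by
    intro m
    beta_reduce
    rw [show n + 1 - k + m = n + 1 + m - k by omega, show k + (n + 1 + m - k) = n + 1 + m by omega]
    push_cast
    ring
  simp only [e]
  rw [← sum_image (g := fun m => n + 1 - k + m)
    (f := fun j => (k.choose j : ℝ) * harm (k + j) * b k) (by intro a _ b _ h; simpa using h)]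
  refine sum_subset_zero_on_sdiff ?_ ?_ fun _ _ => rfl
  · intro j hj
    rw [mem_filter, mem_range] at hj
    rw [mem_image]
    exact ⟨j - (n + 1 - k), mem_range.2 (by omega), by omega⟩
  · intro j hj
    simp only [Finset.mem_sdiff, mem_image, mem_filter, mem_range, not_and, not_lt] at hj
    obtain ⟨⟨m, hm, rfl⟩, h2⟩ := hj
    rw [Nat.choose_eq_zero_of_lt]
    · simp
    · by_contra h
      have := h2 (by omega)
      omega

lemma b_pos {n : ℕ} (hn : 1 ≤ n) : 0 < b n := by
  induction n, hn using Nat.le_induction with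
  | base => simp [b_one]
  | succ n hn ih =>
    rw [b_rec (by omega)]
    have := single_le_sum (f := fun k => k.choose (n + 1 - k) * b k) (fun _ _ => Nat.zero_le _)
      (mem_range.2 (Nat.lt_succ_self n))
    simp only [Nat.add_sub_cancel_left, Nat.choose_one_right] at this
    exact (Nat.mul_pos hn ih).trans_le this

/-- The list `a + x * r`, entrywise. -/
def addMul (x : ℕ) : List ℕ → List ℕ → List ℕ
  | [], r => r.map (x * ·)
  | a, [] => a
  | a :: as, r :: rs => (a + x * r) :: addMul x as rs

/-- The next row of Pascal's triangle, for `p = 0`. -/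
def pascal : ℕ → List ℕ → List ℕ
  | p, [] => [p]
  | p, r :: rs => (p + r) :: pascal r rs

/-- One step of the computation of `contrib`. -/
def contribStep (s : List ℕ × List ℕ) : List ℕ × List ℕ :=
  match s with
  | (a :: as, _ :: rs) => (addMul a as rs, pascal 0 s.2)
  | _ => s

/-- The values of `contrib (n + 1)` and the binomial coefficients `C(n + 2, ·)`. -/
def contribList : ℕ → List ℕ × List ℕ
  | 0 => ([1], [1, 2, 1])
  | n + 1 => contribStep (contribList n)

lemma addMul_getD (x : ℕ) (l r : List ℕ) (m : ℕ) :
    (addMul x l r).getD m 0 = l.getD m 0 + x * r.getD m 0 := by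
  induction l, r using addMul.induct generalizing m with
  | case1 r => simp [addMul, List.getD_eq_getElem?_getD]; cases r[m]? <;> simp
  | case2 a h => cases a <;> simp_all [addMul]
  | case3 a as r rs ih => cases m <;> simp_all [addMul]

lemma pascal_getD_zero (p : ℕ) (r : List ℕ) : (pascal p r).getD 0 0 = p + r.getD 0 0 := by
  cases r <;> simp [pascal]

lemma pascal_getD_succ (p : ℕ) (r : List ℕ) (m : ℕ) :
    (pascal p r).getD (m + 1) 0 = r.getD m 0 + r.getD (m + 1) 0 := by
  induction r generalizing p m with
  | nil => simp [pascal]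
  | cons a r ih =>
    rw [pascal, List.getD_cons_succ, List.getD_cons_succ]
    cases m with
    | zero => rw [pascal_getD_zero, List.getD_cons_zero]
    | succ m => rw [ih, List.getD_cons_succ]

/-- The head of the first list is already the next count `b (n + 2)`. A step drops it and adds its
multiple of the binomial row, so the recurrence runs without storing earlier counts. -/
lemma contribList_getD (n : ℕ) :
    (∀ m, (contribList n).1.getD m 0 = contrib (n + 1) (n + 2 + m)) ∧
      ∀ m, (contribList n).2.getD m 0 = (n + 2).choose m := by
  induction n with
  | zero =>
    constructor
    · rintro (_ | m)
      · simp [contribList, contrib, sum_range_succ, b_one, b_zero]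
      · rw [contrib_eq_zero (by omega)]
        simp [contribList]
    · rintro (_ | _ | _ | m)
      · simp [contribList]
      · simp [contribList]
      · simp [contribList]
      · rw [Nat.choose_eq_zero_of_lt (by omega)]
        simp [contribList]
  | succ n ih =>
    obtain ⟨h1, h2⟩ := ih
    rw [contribList]
    rcases hs : contribList n with ⟨l, r⟩
    rw [hs] at h1 h2
    simp only at h1 h2
    have hb := b_pos (by omega : 1 ≤ n + 2)
    cases l with
    | nil =>
      have := h1 0
      rw [add_zero, contrib_self (by omega)] at this
      exact absurd this.symm hb.ne'
    | cons a as =>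
      have ha : a = b (n + 2) := by
        have := h1 0
        rw [add_zero, contrib_self (by omega)] at this
        simpa using this
      cases r with
      | nil =>
        have := h2 0
        simp at this
      | cons c rs =>
        constructor
        · intro m
          simp only [contribStep]
          rw [addMul_getD, contrib_succ, ha]
          have e1 := h1 (m + 1)
          have e2 := h2 (m + 1)
          rw [List.getD_cons_succ] at e1 e2
          rw [e1, e2, show n + 2 + (m + 1) = n + 1 + 2 + m by ring,
            show n + 1 + 2 + m - (n + 1 + 1) = m + 1 by omega]
        · rintro (_ | m)
          · have := h2 0
            simp only [contribStep]
            rw [pascal_getD_zero, this]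
            simp
          · simp only [contribStep]
            rw [pascal_getD_succ, h2, h2, show n + 1 + 2 = n + 2 + 1 by ring, Nat.choose_succ_succ (n + 2)]

/-- An upper bound for `∑ₘ lₘ harm (i + m)` up to scaling, in integer arithmetic. -/
def dotUpper : ℕ → ℕ → List ℕ → ℕ
  | _, _, [] => 0
  | g, i, a :: as =>
      a * (g + (g * 933373688 * 10 ^ 10 / (10 ^ 9 * (i * 10 ^ 10 - 6931471807)) + 1) -
        g * 155867 / (10 ^ 6 * (i * (i + 1)))) +
      dotUpper (g * 6931471807 / (i * 10 ^ 10 - 6931471807) + 1) (i + 1) as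

/-- A lower bound for `∑ₘ lₘ harm (i + m)` up to scaling, in integer arithmetic. -/
def dotLower : ℕ → ℕ → List ℕ → ℕ
  | _, _, [] => 0
  | g, i, a :: as =>
      a * (g + g * 933373687 * 10 ^ 10 / (10 ^ 9 * (i * 10 ^ 10 - 6931471804)) -
        (g * 155869 / (10 ^ 6 * ((i - 1) * i)) + 1)) +
      dotLower (g * 6931471804 / (i * 10 ^ 10 - 6931471804)) (i + 1) as

lemma lead_succ {i : ℕ} (hi : 1 ≤ i) : ℓ ^ (i + 1) / Real.Gamma ((i + 1 : ℕ) - ℓ) =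
    ℓ ^ i / Real.Gamma (i - ℓ) * (ℓ / (i - ℓ)) := by
  have hx := sub_log_two_pos hi
  have hg := (Real.Gamma_pos_of_pos hx).ne'
  push_cast
  rw [show (i : ℝ) + 1 - ℓ = i - ℓ + 1 by ring, Real.Gamma_add_one hx.ne', pow_succ]
  field_simp

lemma lead_pos {i : ℕ} (hi : 1 ≤ i) : 0 < ℓ ^ i / Real.Gamma (i - ℓ) := by
  have hg := Real.Gamma_pos_of_pos (sub_log_two_pos hi)
  have := log_two_pos
  positivity

/-- As `d₂` is negative, its denominator is enlarged to i(i + 1) here; the lower bound shrinks it to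
(i - 1)i instead. -/
lemma corr_le {i : ℕ} (hi : 1 ≤ i) : corr i ≤
    1 + 933373688 * 10 ^ 10 / (10 ^ 9 * (i * 10 ^ 10 - 6931471807)) -
      155867 / (10 ^ 6 * (i * (i + 1))) := by
  have hi' : (1 : ℝ) ≤ i := by exact_mod_cast hi
  have hx := sub_log_two_pos hi
  have h1 := d₁_bounds.2
  have h2 := d₂_bounds.2
  have g2 := log_two_lt
  have g0 := log_two_pos
  have hy : (0 : ℝ) < i - 0.6931471807 := by linarith
  have t1 : d₁ / (i - ℓ) ≤ 0.933373688 / (i - 0.6931471807) := by gcongr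
  have t2 : 0.155867 / ((i : ℝ) * (i + 1)) ≤ (-d₂) / ((i - ℓ) * (i - ℓ + 1)) := by
    gcongr <;> linarith
  have e1 : (933373688 : ℝ) * 10 ^ 10 / (10 ^ 9 * (i * 10 ^ 10 - 6931471807)) =
      0.933373688 / (i - 0.6931471807) := by
    rw [show (i : ℝ) * 10 ^ 10 - 6931471807 = 10 ^ 10 * (i - 0.6931471807) by ring]
    field_simp
    norm_num
  have e2 : (155867 : ℝ) / (10 ^ 6 * (i * (i + 1))) = 0.155867 / ((i : ℝ) * (i + 1)) := by
    field_simp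
    norm_num
  rw [e1, e2, corr]
  rw [neg_div] at t2
  linarith

lemma le_corr {i : ℕ} (hi : 2 ≤ i) :
    1 + 933373687 * 10 ^ 10 / (10 ^ 9 * (i * 10 ^ 10 - 6931471804)) -
      155869 / (10 ^ 6 * ((i - 1) * i)) ≤ corr i := by
  have hi' : (2 : ℝ) ≤ i := by exact_mod_cast hi
  have hx := sub_log_two_pos (by omega : 1 ≤ i)
  have h1 := d₁_bounds.1
  have h2 := d₂_bounds.1
  have g1 := log_two_gt
  have g2 := log_two_lt
  have hy : (0 : ℝ) < i - 0.6931471804 := by linarith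
  have hi1 : (0 : ℝ) < i - 1 := by linarith
  have t1 : 0.933373687 / (i - 0.6931471804) ≤ d₁ / (i - ℓ) := by gcongr
  have t2 : (-d₂) / ((i - ℓ) * (i - ℓ + 1)) ≤ 0.155869 / (((i : ℝ) - 1) * i) := by
    gcongr <;> linarith
  have e1 : (933373687 : ℝ) * 10 ^ 10 / (10 ^ 9 * (i * 10 ^ 10 - 6931471804)) =
      0.933373687 / (i - 0.6931471804) := by
    rw [show (i : ℝ) * 10 ^ 10 - 6931471804 = 10 ^ 10 * (i - 0.6931471804) by ring]
    field_simp
    norm_num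
  have e2 : (155869 : ℝ) / (10 ^ 6 * ((i - 1) * i)) = 0.155869 / (((i : ℝ) - 1) * i) := by
    field_simp
    norm_num
  rw [e1, e2, corr]
  rw [neg_div] at t2
  linarith

/-- The integer g bounds the scaled leading factor of `harm i`. Passing to i + 1 multiplies that
factor by ℓ / (i - ℓ), and each integer division is rounded in the safe direction. -/
lemma le_dotUpper {c : ℝ} (l : List ℕ) {g i : ℕ} (hi : 1 ≤ i)
    (hg : c * (ℓ ^ i / Real.Gamma (i - ℓ)) ≤ g) :
    c * ∑ m ∈ range l.length, (l.getD m 0 : ℝ) * harm (i + m) ≤ dotUpper g i l := by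
  induction l generalizing g i with
  | nil => simp [dotUpper]
  | cons a as ih =>
    have hi' : (1 : ℝ) ≤ i := by exact_mod_cast hi
    have hx := sub_log_two_pos hi
    have g2 := log_two_lt
    have g0 := log_two_pos
    have hlead := lead_pos hi
    have hcast : ((i * 10 ^ 10 - 6931471807 : ℕ) : ℝ) = i * 10 ^ 10 - 6931471807 := by
      rw [Nat.cast_sub (by omega)]; push_cast; ring
    have hpos : (0 : ℝ) < i * 10 ^ 10 - 6931471807 := by linarith
    rw [List.length_cons, sum_range_succ', dotUpper]
    simp only [List.getD_cons_succ, List.getD_cons_zero, add_zero]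
    have hnext : c * (ℓ ^ (i + 1) / Real.Gamma ((i + 1 : ℕ) - ℓ)) ≤
        ((g * 6931471807 / (i * 10 ^ 10 - 6931471807) + 1 : ℕ) : ℝ) := by
      rw [lead_succ hi]
      have h1 : ℓ / (i - ℓ) ≤ 6931471807 / (i * 10 ^ 10 - 6931471807) := by
        rw [div_le_div_iff₀ hx hpos]
        nlinarith
      have h2 := Nat.lt_floor_add_one ((g * 6931471807 : ℕ) / ((i * 10 ^ 10 - 6931471807 : ℕ) : ℝ))
      rw [Nat.floor_div_eq_div, hcast] at h2
      push_cast at h2 ⊢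
      calc _ = c * (ℓ ^ i / Real.Gamma (i - ℓ)) * (ℓ / (i - ℓ)) := by ring
        _ ≤ g * (6931471807 / (i * 10 ^ 10 - 6931471807)) :=
            mul_le_mul hg h1 (by positivity) (Nat.cast_nonneg _)
        _ = (g * 6931471807) / (i * 10 ^ 10 - 6931471807) := by ring
        _ ≤ _ := h2.le
    have hrec := ih (by omega : 1 ≤ i + 1) hnext
    have hhead : c * harm i ≤ ((g + (g * 933373688 * 10 ^ 10 /
        (10 ^ 9 * (i * 10 ^ 10 - 6931471807)) + 1) - g * 155867 / (10 ^ 6 * (i * (i + 1))) : ℕ) :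
          ℝ) := by
      have h1 := Nat.lt_floor_add_one ((g * 933373688 * 10 ^ 10 : ℕ) /
        ((10 ^ 9 * (i * 10 ^ 10 - 6931471807) : ℕ) : ℝ))
      rw [Nat.floor_div_eq_div] at h1
      have h2 : ((g * 155867 / (10 ^ 6 * (i * (i + 1))) : ℕ) : ℝ) ≤
        (g * 155867 : ℕ) / ((10 ^ 6 * (i * (i + 1)) : ℕ) : ℝ) := Nat.cast_div_le
      have h3 : ((g + (g * 933373688 * 10 ^ 10 / (10 ^ 9 * (i * 10 ^ 10 - 6931471807)) + 1) : ℕ) :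
          ℝ) ≤ (g * 155867 / (10 ^ 6 * (i * (i + 1))) : ℕ) + ((g + (g * 933373688 * 10 ^ 10 /
        (10 ^ 9 * (i * 10 ^ 10 - 6931471807)) + 1) - g * 155867 / (10 ^ 6 * (i * (i + 1))) : ℕ) :
          ℝ) := by exact_mod_cast le_add_tsub
      rw [Nat.cast_add g, Nat.cast_add _ 1] at h3
      rw [Nat.cast_mul (10 ^ 9), hcast] at h1
      push_cast at h1 h2
      have h4 : c * harm i ≤ g * corr i := by
        rw [harm_eq_mul_corr, ← mul_assoc]
        exact mul_le_mul_of_nonneg_right hg (by linarith [one_le_corr hi])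
      have h5 := mul_le_mul_of_nonneg_left (corr_le hi) (Nat.cast_nonneg (α := ℝ) g)
      have e1 : (g : ℝ) * (1 + 933373688 * 10 ^ 10 / (10 ^ 9 * (i * 10 ^ 10 - 6931471807)) -
          155867 / (10 ^ 6 * (i * (i + 1)))) = g + g * 933373688 * 10 ^ 10 /
          (10 ^ 9 * (i * 10 ^ 10 - 6931471807)) - g * 155867 / (10 ^ 6 * (i * (i + 1))) := by ring
      rw [e1] at h5
      push_cast at h3
      linarith
    have hh := mul_le_mul_of_nonneg_left hhead (Nat.cast_nonneg (α := ℝ) a)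
    rw [Nat.cast_add, Nat.cast_mul, mul_add]
    have e : ∑ m ∈ range as.length, (as.getD m 0 : ℝ) * harm (i + (m + 1)) =
        ∑ m ∈ range as.length, (as.getD m 0 : ℝ) * harm (i + 1 + m) :=
      sum_congr rfl fun m _ => by rw [show i + (m + 1) = i + 1 + m by ring]
    rw [e]
    linarith

lemma dotLower_le {c : ℝ} (hc : 0 ≤ c) (l : List ℕ) {g i : ℕ} (hi : 2 ≤ i)
    (hg : (g : ℝ) ≤ c * (ℓ ^ i / Real.Gamma (i - ℓ))) :
    (dotLower g i l : ℝ) ≤ c * ∑ m ∈ range l.length, (l.getD m 0 : ℝ) * harm (i + m) := by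
  induction l generalizing g i with
  | nil => simp [dotLower]
  | cons a as ih =>
    have hi' : (2 : ℝ) ≤ i := by exact_mod_cast hi
    have hx := sub_log_two_pos (by omega : 1 ≤ i)
    have g1 := log_two_gt
    have g0 := log_two_pos
    have hlead := lead_pos (by omega : 1 ≤ i)
    have hcast : ((i * 10 ^ 10 - 6931471804 : ℕ) : ℝ) = i * 10 ^ 10 - 6931471804 := by
      rw [Nat.cast_sub (by omega)]; push_cast; ring
    have hpos : (0 : ℝ) < i * 10 ^ 10 - 6931471804 := by linarith
    rw [List.length_cons, sum_range_succ', dotLower]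
    simp only [List.getD_cons_succ, List.getD_cons_zero, add_zero]
    have hnext : ((g * 6931471804 / (i * 10 ^ 10 - 6931471804) : ℕ) : ℝ) ≤
        c * (ℓ ^ (i + 1) / Real.Gamma ((i + 1 : ℕ) - ℓ)) := by
      rw [lead_succ (by omega : 1 ≤ i)]
      have h1 : 6931471804 / (i * 10 ^ 10 - 6931471804) ≤ ℓ / (i - ℓ) := by
        rw [div_le_div_iff₀ hpos hx]
        nlinarith
      have h2 : ((g * 6931471804 / (i * 10 ^ 10 - 6931471804) : ℕ) : ℝ) ≤
        (g * 6931471804 : ℕ) / ((i * 10 ^ 10 - 6931471804 : ℕ) : ℝ) := Nat.cast_div_le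
      rw [hcast] at h2
      push_cast at h2
      calc _ ≤ (g : ℝ) * 6931471804 / (i * 10 ^ 10 - 6931471804) := h2
        _ = g * (6931471804 / (i * 10 ^ 10 - 6931471804)) := by ring
        _ ≤ c * (ℓ ^ i / Real.Gamma (i - ℓ)) * (ℓ / (i - ℓ)) :=
            mul_le_mul hg h1 (by positivity) (by positivity)
        _ = _ := by ring
    have hrec := ih (by omega : 2 ≤ i + 1) hnext
    have hhead : ((g + g * 933373687 * 10 ^ 10 / (10 ^ 9 * (i * 10 ^ 10 - 6931471804)) -
        (g * 155869 / (10 ^ 6 * ((i - 1) * i)) + 1) : ℕ) : ℝ) ≤ c * harm i := by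
      have h1 := Nat.lt_floor_add_one ((g * 155869 : ℕ) / ((10 ^ 6 * ((i - 1) * i) : ℕ) : ℝ))
      rw [Nat.floor_div_eq_div] at h1
      have h2 : ((g * 933373687 * 10 ^ 10 / (10 ^ 9 * (i * 10 ^ 10 - 6931471804)) : ℕ) : ℝ) ≤
        (g * 933373687 * 10 ^ 10 : ℕ) / ((10 ^ 9 * (i * 10 ^ 10 - 6931471804) : ℕ) : ℝ) :=
        Nat.cast_div_le
      have h0 : 0 ≤ c * harm i := mul_nonneg hc (harm_pos (by omega)).le
      rcases le_total (g + g * 933373687 * 10 ^ 10 / (10 ^ 9 * (i * 10 ^ 10 - 6931471804)))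
        (g * 155869 / (10 ^ 6 * ((i - 1) * i)) + 1) with h | h
      · rw [Nat.sub_eq_zero_of_le h]
        simpa using h0
      rw [Nat.cast_sub h, Nat.cast_add g, Nat.cast_add _ 1]
      rw [Nat.cast_mul (10 ^ 9), hcast] at h2
      rw [Nat.cast_mul (10 ^ 6), Nat.cast_mul (i - 1), Nat.cast_sub (by omega : 1 ≤ i)] at h1
      push_cast at h1 h2
      have h4 : g * corr i ≤ c * harm i := by
        rw [harm_eq_mul_corr, ← mul_assoc]
        exact mul_le_mul_of_nonneg_right hg (by linarith [one_le_corr (by omega : 1 ≤ i)])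
      have h5 := mul_le_mul_of_nonneg_left (le_corr hi) (Nat.cast_nonneg (α := ℝ) g)
      have e1 : (g : ℝ) * (1 + 933373687 * 10 ^ 10 / (10 ^ 9 * (i * 10 ^ 10 - 6931471804)) -
          155869 / (10 ^ 6 * ((i - 1) * i))) = g + g * 933373687 * 10 ^ 10 /
          (10 ^ 9 * (i * 10 ^ 10 - 6931471804)) - g * 155869 / (10 ^ 6 * ((i - 1) * i)) := by ring
      rw [e1] at h5
      push_cast
      linarith
    have hh := mul_le_mul_of_nonneg_left hhead (Nat.cast_nonneg (α := ℝ) a)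
    rw [Nat.cast_add, Nat.cast_mul, mul_add]
    have e : ∑ m ∈ range as.length, (as.getD m 0 : ℝ) * harm (i + (m + 1)) =
        ∑ m ∈ range as.length, (as.getD m 0 : ℝ) * harm (i + 1 + m) :=
      sum_congr rfl fun m _ => by rw [show i + (m + 1) = i + 1 + m by ring]
    rw [e]
    linarith

lemma invar_eq_sum_contribList (n : ℕ) :
    invar (n + 1) = ∑ m ∈ range (contribList n).1.length,
      ((contribList n).1.getD m 0 : ℝ) * harm (n + 2 + m) := by
  have h := (contribList_getD n).1
  have e1 : invar (n + 1) = ∑ m ∈ range (max (n + 1) (contribList n).1.length),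
      ((contribList n).1.getD m 0 : ℝ) * harm (n + 2 + m) := by
    rw [invar_eq_sum_contrib]
    simp only [h]
    refine sum_subset (range_subset_range.2 (le_max_left _ _)) fun m _ hm => ?_
    rw [mem_range, not_lt] at hm
    rw [contrib_eq_zero (by omega)]
    simp
  rw [e1]
  symm
  refine sum_subset (range_subset_range.2 (le_max_right _ _)) fun m _ hm => ?_
  rw [mem_range, not_lt] at hm
  rw [List.getD_eq_default _ _ hm]
  simp

/-- The scale of the integer arithmetic. -/
def scale : ℕ := 2 ^ 2600

/-- A lower bound for `invar 256 * Γ(257 - ℓ) / ℓ ^ 257`. -/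
def massLower : ℕ := 13338525557 * 10 ^ 536

/-- An upper bound for `invar 256 * Γ(257 - ℓ) / ℓ ^ 257`. -/
def massUpper : ℕ := 13338525804 * 10 ^ 536

lemma scale_pos : 0 < scale := by decide +kernel

/-- Over the 256 entries the running factor loses roughly 2300 bits, so the scale 2^2600 keeps
rounding negligible to the end. -/
lemma dotUpper_le_massUpper :
    dotUpper scale 257 (contribList 255).1 ≤ massUpper * scale := by
  decide +kernel

lemma massLower_le_dotLower :
    massLower * scale ≤ dotLower scale 257 (contribList 255).1 := by
  decide +kernel

/-! ### Numerical enclosure of the constant. -/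

/-- Since 256 = 2^8, the power 256^ℓ equals exp(8ℓ²). Splitting off 32 = exp(5ℓ) leaves an exponent
in (0, 1), where Taylor bounds for exp apply. -/
lemma lead_256 : ℓ ^ 257 / Real.Gamma ((257 : ℕ) - ℓ) = ℓ ^ 256 * ℓ * 32 *
    Real.exp (8 * ℓ ^ 2 - 5 * ℓ - Real.log (gratio 256)) /
      (Nat.factorial 255 * (256 - ℓ)) := by
  have hg := Real.Gamma_pos_of_pos (sub_log_two_pos (by norm_num : 1 ≤ 256))
  have hr := gratio_pos (by norm_num : 1 ≤ 256)
  have h256 : Real.Gamma ((256 : ℕ) : ℝ) = Nat.factorial 255 := by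
    rw [← Real.Gamma_nat_eq_factorial]
    norm_num
  have hp : ((256 : ℕ) : ℝ) ^ ℓ = 32 * Real.exp (8 * ℓ ^ 2 - 5 * ℓ) := by
    have e1 : Real.log ((256 : ℕ) : ℝ) = 8 * ℓ := by
      rw [show ((256 : ℕ) : ℝ) = 2 ^ 8 by norm_num, Real.log_pow]; norm_num
    have e2 : (32 : ℝ) = Real.exp (5 * ℓ) := by
      rw [show 5 * ℓ = Real.log (2 ^ 5) by rw [Real.log_pow]; norm_num,
        Real.exp_log (by positivity)]
      norm_num
    rw [Real.rpow_def_of_pos (by norm_num), e1, e2, ← Real.exp_add]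
    congr 1
    ring
  have hG : Real.Gamma ((256 : ℕ) - ℓ) =
      gratio 256 * Nat.factorial 255 / (32 * Real.exp (8 * ℓ ^ 2 - 5 * ℓ)) := by
    rw [← hp, ← h256, gratio]
    have : 0 < ((256 : ℕ) : ℝ) ^ ℓ := by positivity
    have h2 : Real.Gamma ((256 : ℕ) : ℝ) ≠ 0 := by rw [h256]; positivity
    field_simp
  have h1 := lead_succ (by norm_num : 1 ≤ 256)
  have h3 : (256 : ℝ) - ℓ ≠ 0 := by linarith [log_two_lt_one]
  rw [h1, hG, Real.exp_sub _ (Real.log _), Real.exp_log hr]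
  push_cast
  field_simp

lemma exponent_bounds : 0.375592395 < 8 * ℓ ^ 2 - 5 * ℓ - Real.log (gratio 256) ∧
    8 * ℓ ^ 2 - 5 * ℓ - Real.log (gratio 256) < 0.375592524 := by
  obtain ⟨h1, h2⟩ := log_gratio_mem (by norm_num : 100 ≤ 256)
  have g1 := log_two_gt
  have g2 := log_two_lt
  have l2 : 0.48045301349 < ℓ ^ 2 := by nlinarith
  have l2' : ℓ ^ 2 < 0.48045301412 := by nlinarith
  have l3 : ℓ ^ 3 < 0.33303 := by nlinarith
  have l3' : 0.33302 < ℓ ^ 3 := by nlinarith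
  rw [lgApprox] at h1 h2
  norm_num at h1 h2
  constructor <;> linarith

lemma exp_exponent_bounds :
    1.4558535 < Real.exp (8 * ℓ ^ 2 - 5 * ℓ - Real.log (gratio 256)) ∧
    Real.exp (8 * ℓ ^ 2 - 5 * ℓ - Real.log (gratio 256)) < 1.4558538 := by
  obtain ⟨h1, h2⟩ := exponent_bounds
  constructor
  · have h3 := Real.sum_le_exp_of_nonneg (x := 0.375592395) (by norm_num) 10
    have h4 := Real.exp_lt_exp.2 h1
    refine lt_of_lt_of_le ?_ (h3.trans h4.le)
    simp only [sum_range_succ, sum_range_zero, Nat.factorial]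
    norm_num
  · have h3 := Real.exp_bound' (x := 0.375592524) (by norm_num) (by norm_num)
      (by norm_num : 0 < 10)
    have h4 := Real.exp_lt_exp.2 h2
    refine lt_of_lt_of_le h4 (h3.trans ?_)
    simp only [sum_range_succ, sum_range_zero, Nat.factorial]
    norm_num

lemma invar_256_lead_bounds :
    massLower * (ℓ ^ 257 / Real.Gamma ((257 : ℕ) - ℓ)) ≤ invar 256 ∧
      invar 256 ≤ massUpper * (ℓ ^ 257 / Real.Gamma ((257 : ℕ) - ℓ)) := by
  have hlead := lead_pos (by norm_num : 1 ≤ 257)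
  set q := ℓ ^ 257 / Real.Gamma ((257 : ℕ) - ℓ) with hq
  have hs' : (0 : ℝ) < scale := Nat.cast_pos.2 scale_pos
  have hcl : scale / q * q = scale := div_mul_cancel₀ _ hlead.ne'
  have hU := le_dotUpper (c := scale / q) (contribList 255).1 (by norm_num : 1 ≤ 257) hcl.le
  have hL := dotLower_le (c := scale / q) (div_nonneg hs'.le hlead.le) (contribList 255).1
    (by norm_num : 2 ≤ 257) hcl.ge
  rw [← invar_eq_sum_contribList 255] at hU hL
  have hU'' := hU.trans (Nat.cast_le.2 dotUpper_le_massUpper)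
  have hL'' := (Nat.cast_le.2 massLower_le_dotLower).trans hL
  rw [Nat.cast_mul] at hU'' hL''
  rw [div_mul_eq_mul_div, div_le_iff₀ hlead] at hU''
  rw [div_mul_eq_mul_div, le_div_iff₀ hlead] at hL''
  constructor
  · refine le_of_mul_le_mul_left ?_ hs'
    linarith
  · refine le_of_mul_le_mul_left ?_ hs'
    linarith

section

set_option exponentiation.threshold 3000
set_option maxRecDepth 10000

lemma massLower_bound : (0.647807 : ℝ) * 2 < massLower * ((0.6931471804 : ℝ) ^ 256 * 32 *
    1.4558535 / (Nat.factorial 255 * (256 - 0.6931471804))) *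
    (1 - 5.9 / (256 * 257 * 258)) := by
  rw [massLower]
  norm_num [Nat.factorial]

lemma massUpper_bound : massUpper * ((0.6931471807 : ℝ) ^ 256 * 32 *
    1.4558538 / (Nat.factorial 255 * (256 - 0.6931471807))) *
    (1 + 5.9 / (256 * 257 * 258)) < (0.647808 : ℝ) * 2 := by
  rw [massUpper]
  norm_num [Nat.factorial]

end

/-- The constant in the asymptotics is close to the value of the invariant at `256`. -/
lemma invar_256_bounds :
    0.647807 * (2 * ℓ) < invar 256 * (1 - tele 256) ∧
      invar 256 * (1 + tele 256) < 0.647808 * (2 * ℓ) := by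
  obtain ⟨h1, h2⟩ := invar_256_lead_bounds
  have k1 := massLower_bound
  have k2 := massUpper_bound
  have m1 : (0 : ℝ) ≤ massLower := Nat.cast_nonneg _
  have m2 : (0 : ℝ) ≤ massUpper := Nat.cast_nonneg _
  generalize (massLower : ℝ) = lo at h1 k1 m1
  generalize (massUpper : ℝ) = hi at h2 k2 m2
  obtain ⟨e1, e2⟩ := exp_exponent_bounds
  have g1 := log_two_gt
  have g2 := log_two_lt
  have g0 := log_two_pos
  rw [lead_256] at h1 h2
  set E := Real.exp (8 * ℓ ^ 2 - 5 * ℓ - Real.log (gratio 256))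
  have ht : tele 256 = 5.9 / (256 * 257 * 258) := by rw [tele]; norm_num
  have f : (0 : ℝ) < Nat.factorial 255 := by positivity
  have x1 : (0 : ℝ) < 256 - ℓ := by linarith
  generalize (Nat.factorial 255 : ℝ) = F at h1 h2 k1 k2 f
  rw [ht]
  constructor
  · have h3 : (0.6931471804 : ℝ) ^ 256 * 32 * 1.4558535 / (F *
        (256 - 0.6931471804)) * ℓ ≤ ℓ ^ 256 * ℓ * 32 * E / (F * (256 - ℓ)) := by
      rw [show ℓ ^ 256 * ℓ * 32 * E / (F * (256 - ℓ)) =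
        ℓ ^ 256 * 32 * E / (F * (256 - ℓ)) * ℓ by ring]
      gcongr
    have h4 := (mul_le_mul_of_nonneg_left h3 m1).trans h1
    refine lt_of_lt_of_le ?_ (mul_le_mul_of_nonneg_right h4 (by norm_num))
    -- The precomputed inequality was divided by the common factor ℓ, which is restored here.
    have h6 := mul_lt_mul_of_pos_right k1 g0
    linarith
  · have h3 : ℓ ^ 256 * ℓ * 32 * E / (F * (256 - ℓ)) ≤
        (0.6931471807 : ℝ) ^ 256 * 32 * 1.4558538 / (F *
        (256 - 0.6931471807)) * ℓ := by
      rw [show ℓ ^ 256 * ℓ * 32 * E / (F * (256 - ℓ)) =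
        ℓ ^ 256 * 32 * E / (F * (256 - ℓ)) * ℓ by ring]
      gcongr
    have h4 := h2.trans (mul_le_mul_of_nonneg_left h3 m2)
    refine lt_of_le_of_lt (mul_le_mul_of_nonneg_right h4 (by norm_num)) ?_
    have h6 := mul_lt_mul_of_pos_right k2 g0
    linarith

/-! ### Conclusion. -/

/-- For n ≥ 2 the quotient of the two sides is exactly `nb n` · `gratio n` / (c · `corr n`). -/
theorem isEquivalent_B {c : ℝ} (hc0 : 0 < c) (hc : Tendsto nb atTop (𝓝 c)) :
    Asymptotics.IsEquivalent atTop (fun n : ℕ => (B n : ℝ))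
      (fun n : ℕ => c * (n : ℝ) ^ (-ℓ) * (1 / ℓ) ^ n * (Nat.factorial (n - 1) : ℝ)) := by
  have hl := log_two_pos
  refine (Asymptotics.isEquivalent_of_tendsto_one ?_)
  have h := ((hc.mul tendsto_gratio).div_const c).div tendsto_corr one_ne_zero
  rw [mul_one, div_self hc0.ne', div_one] at h
  refine h.congr' ?_
  filter_upwards [eventually_ge_atTop 2] with n hn
  have h0 : (0 : ℝ) < n := by positivity
  have hg := Real.Gamma_pos_of_pos (sub_log_two_pos (by omega : 1 ≤ n))
  have hf : (Nat.factorial (n - 1) : ℝ) = Real.Gamma n := by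
    rw [← Real.Gamma_nat_eq_factorial, Nat.cast_sub (by omega)]
    simp
  have hg' := Real.Gamma_pos_of_pos h0
  have hk := one_le_corr (by omega : 1 ≤ n)
  have hk' : corr n ≠ 0 := by linarith
  have hp : 0 < (n : ℝ) ^ ℓ := by positivity
  simp only [Pi.div_apply]
  rw [nb, harm_eq_mul_corr, gratio, B_eq_b hn, hf, Real.rpow_neg h0.le, one_div, inv_pow]
  field_simp

end WeaklyIncreasing

theorem mainTheorem1 :
    (∀ n : ℕ, (WeaklyIncreasing.treesOfSize n).Finite) ∧
    ∃ η : ℝ, (0.647807 : ℝ) < η ∧ η < (0.647808 : ℝ) ∧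
      Asymptotics.IsEquivalent Filter.atTop
        (fun n : ℕ => (WeaklyIncreasing.B n : ℝ))
        (fun n : ℕ => η * (n : ℝ) ^ (-Real.log 2) * (1 / Real.log 2) ^ n *
          (Nat.factorial (n - 1) : ℝ)) := by
  refine ⟨WeaklyIncreasing.treesOfSize_finite, ?_⟩
  obtain ⟨c, hc, hb⟩ := WeaklyIncreasing.exists_tendsto_invar
  -- At n = 256 the relative error `tele n` is about 3.5 · 10⁻⁷, below the relative width 1.5 · 10⁻⁶
  -- of the required window.
  obtain ⟨h1, h2⟩ := hb 256 (by norm_num)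
  obtain ⟨h3, h4⟩ := WeaklyIncreasing.invar_256_bounds
  have hl : 0 < 2 * Real.log 2 := by linarith [WeaklyIncreasing.log_two_pos]
  have h5 : 0.647807 < c / (2 * Real.log 2) := by
    rw [lt_div_iff₀ hl]; linarith
  refine ⟨c / (2 * Real.log 2), h5, ?_, ?_⟩
  · rw [div_lt_iff₀ hl]; linarith
  · refine WeaklyIncreasing.isEquivalent_B (by linarith) (WeaklyIncreasing.tendsto_nb ?_)
    rwa [mul_div_cancel₀ _ hl.ne']
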